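/- For a finite group $G$ and a positive integer $k$ let $N_k(G)$ be the number of irreducible complex characters $\chi$ of $G$ with $\chi(1)=k$. For $n\ge 0$ and a finite field $\mathbf F$ with $q$ elements let $U_n=U_n(q)$ be the group of upper triangular $n\times n$ matrices over $\mathbf F$ with all diagonal entries equal to $1$. Then the following hold. (1) For every prime power $q$, $$N_{q^3}(U_5)=q(q-1)(2q-1),\qquad N_{q^3}(U_6)=q^2(q-1)(4q^2+q-3),$$ $$N_{q^3}(U_7)=q^2(q-1)(3q^4+6q^3-2q^2-5q+1).$$ (2) For every prime power $q$ and every $n\ge 8$, $$N_{q^3}(U_n)=q\,N_{q^3}(U_{n-1})+q^{n-5}(q-1)\Big\{q^5+(2n-14)q^4+\Big[25-3n+\tfrac{(n-6)(n-5)}{2}\Big]q^3+\big[n-11-(n-7)(n-6)\big]q^2+\Big[5-n+\tfrac{(n-8)(n-7)}{2}\Big]q+n-6\Big\}.$$ (3) For every prime power $q$ and every $n\ge 7$, $$N_{q^3}(U_n)=q^{n-5}(q-1)\{A_nq^5+B_nq^4+C_nq^3+D_nq^2+E_nq+F_n\},$$ where $$A_n=n-7,\qquad B_n=3+(n-7)(n-6),$$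 $$C_n=40(n-7)-\tfrac{17}{4}(n+8)(n-7)+\tfrac1{12}n(n+1)(2n+1)-64,$$ $$D_n=(n-7)(7n+3)-\tfrac16 n(n+1)(2n+1)+138,$$ $$E_n=(n-7)\big(-\tfrac{17}{4}n-1\big)+\tfrac1{12}n(n+1)(2n+1)-75,\qquad F_n=1+\tfrac{(n-7)(n-4)}{2}.$$ (4) Each of $A_n,B_n,C_n,D_n,E_n,F_n$, regarded as a polynomial in $n$ with rational coefficients, takes an integer value at every integer $n$. (5) Consequently (Lehrer's conjecture for $e=3$): for every $n$ there is a polynomial $P_n$ with integer coefficients such that $N_{q^3}(U_n(q))=P_n(q)$ for every prime power $q$. -/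

import Mathlib

universe u

open Polynomial

noncomputable section

namespace UnitriangularCharacters

/-- The group `U_n(F)` of upper unitriangular `n × n` matrices over `F`, as a subgroup of
`GL_n(F)`: all entries below the diagonal are `0` and all diagonal entries are `1`. -/
def unitriangular (n : ℕ) (F : Type*) [Field F] : Subgroup (GL (Fin n) F) where
  carrier := {g | (∀ i j, j < i → g.1 i j = 0) ∧ ∀ i, g.1 i i = 1}
  one_mem' := by
    refine ⟨fun i j h => ?_, fun i => ?_⟩
    · simp [Matrix.one_apply, h.ne']
    · simp
  mul_mem' := by
    rintro a b ⟨ha, ha'⟩ ⟨hb, hb'⟩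
    refine ⟨fun i j h => ?_, fun i => ?_⟩
    · rw [Units.val_mul, Matrix.mul_apply]
      refine Finset.sum_eq_zero fun k _ => ?_
      rcases lt_or_ge k i with hk | hk
      · rw [ha _ _ hk, zero_mul]
      · rw [hb _ _ (h.trans_le hk), mul_zero]
    · rw [Units.val_mul, Matrix.mul_apply, Finset.sum_eq_single i, ha', hb', one_mul]
      · intro k _ hk
        rcases lt_or_gt_of_ne hk with hk | hk
        · rw [ha _ _ hk, zero_mul]
        · rw [hb _ _ hk, mul_zero]
      · simp
  inv_mem' := by
    rintro a ⟨ha, ha'⟩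
    have hI : ∀ i j, j < i → (a⁻¹).1 i j = 0 := by
      haveI : Invertible a.1 := a.invertible
      have h : Matrix.BlockTriangular (a.1)⁻¹ (id : Fin n → Fin n) :=
        Matrix.blockTriangular_inv_of_blockTriangular fun i j h => ha i j h
      intro i j hij
      rw [Matrix.coe_units_inv]
      exact h hij
    refine ⟨hI, fun i => ?_⟩
    have h1 : (a.1 * (a⁻¹).1) i i = 1 := by
      rw [← Units.val_mul, mul_inv_cancel]
      simp
    rw [Matrix.mul_apply, Finset.sum_eq_single i, ha', one_mul] at h1
    · exact h1
    · intro k _ hk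
      rcases lt_or_gt_of_ne hk with hk | hk
      · rw [ha _ _ hk, zero_mul]
      · rw [hI _ _ hk, mul_zero]
    · simp

/-- `χ : G → ℂ` is an irreducible complex character of `G`: the character of an irreducible
finite-dimensional complex representation. (Every such representation is isomorphic to one on
some `ℂ^d`.) -/
def IsIrredChar {G : Type*} [Group G] (χ : G → ℂ) : Prop :=
  ∃ (d : ℕ) (ρ : Representation ℂ G (Fin d → ℂ)), ρ.IsIrreducible ∧ ρ.character = χ

/-- `N_k(G)`: the number of irreducible complex characters `χ` of `G` of degree `χ(1) = k`. -/
def numIrredChar (k : ℕ) (G : Type*) [Group G] : ℕ :=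
  {χ : G → ℂ | IsIrredChar χ ∧ χ 1 = (k : ℂ)}.ncard

/-! The coefficients of the closed formula, as polynomials over `ℚ` in the variable `n`. -/

/-- `A_n = n - 7`. -/
def coeffA : ℚ[X] := X - 7

/-- `B_n = 3 + (n - 7)(n - 6)`. -/
def coeffB : ℚ[X] := 3 + (X - 7) * (X - 6)

/-- `C_n = 40(n - 7) - (17/4)(n + 8)(n - 7) + (1/12) n (n + 1)(2n + 1) - 64`. -/
def coeffC : ℚ[X] :=
  40 * (X - 7) - C (17 / 4) * (X + 8) * (X - 7) + C (1 / 12) * X * (X + 1) * (2 * X + 1) - 64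

/-- `D_n = (n - 7)(7n + 3) - (1/6) n (n + 1)(2n + 1) + 138`. -/
def coeffD : ℚ[X] :=
  (X - 7) * (7 * X + 3) - C (1 / 6) * X * (X + 1) * (2 * X + 1) + 138

/-- `E_n = (n - 7)(-(17/4) n - 1) + (1/12) n (n + 1)(2n + 1) - 75`. -/
def coeffE : ℚ[X] :=
  (X - 7) * (-C (17 / 4) * X - 1) + C (1 / 12) * X * (X + 1) * (2 * X + 1) - 75

/-- `F_n = 1 + (n - 7)(n - 4)/2`. -/
def coeffF : ℚ[X] := 1 + C (1 / 2) * (X - 7) * (X - 4)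

/-- A rational polynomial is integer-valued if it takes an integer value at every integer. -/
def IsIntegerValued (P : ℚ[X]) : Prop := ∀ m : ℤ, ∃ k : ℤ, P.eval (m : ℚ) = (k : ℚ)

end UnitriangularCharacters

end

/-! `U_n` is a pattern group: its matrices differ from the identity only at a transitively closed
set of positions above the diagonal. If column `a` of a pattern is empty, row `a` is an abelian
normal subgroup `A`, complemented by the pattern group `H` without that row. By the little group
method of Wigner and Mackey, the irreducible characters of `A H` correspond to pairs of an orbit of
characters of `A` and an irreducible character of the stabilizer in `H` of a representative; the
degree gets multiplied by the size of the orbit (`IsDualAction.numIrredChar_eq`).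

The characters of row `a` are column vectors supported on the positions of the row, and the group
acts on them by matrix multiplication, cut back to that support. In the patterns that occur, the
indices above `a` are a set `M` of minimal ones followed by a chain lying above all of them. Orbit
representatives are then the `q ^ |M|` fixed vectors and the vectors `c e_k` with `c ≠ 0` and `k` in
the chain. The orbit of `c e_k` has size `q ^ l`, where `l` counts the indices above `a` and less
than `k`, and its stabilizer in `H` is again a pattern group, with column `k` cleared in the rows
above `a` (`patternCount_eq`, `patternCount_eq_of_chain`). Each orbit of size `q ^ l` thus lowers
the exponent of the degree by `l`, so up to degree `q ^ 3` only a few families of patterns arise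
from the full one.

The resulting recursion `chainThree` makes sense in every commutative ring
(`numIrredChar_unitriangular`). Solved over `ℚ` it yields the explicit formulas (`chainThree_rec`,
`chainThree_closed`); evaluated at the variable of `ℤ[X]` it yields the polynomials of Lehrer's
conjecture, since it commutes with ring homomorphisms (`map_chainThree`). -/

noncomputable section

namespace UnitriangularCharacters

/-! ### Irreducible characters: independence of the model, finiteness, the trivial group. -/

section IrreducibleCharacters

theorem isIrreducible_iff {G V : Type*} [Group G] [AddCommGroup V] [Module ℂ V]
    (ρ : Representation ℂ G V) :
    ρ.IsIrreducible ↔ Nontrivial V ∧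
      ∀ U : Submodule ℂ V, (∀ g, ∀ v ∈ U, ρ g v ∈ U) → U = ⊥ ∨ U = ⊤ := by
  constructor
  · intro h
    refine ⟨?_, fun U hU => ?_⟩
    · by_contra hV
      rw [not_nontrivial_iff_subsingleton] at hV
      exact bot_ne_top (α := Subrepresentation ρ)
        (Subrepresentation.toSubmodule_injective (Subsingleton.elim _ _))
    · rcases eq_bot_or_eq_top (⟨U, fun g v hv => hU g v hv⟩ : Subrepresentation ρ) with h | h
      · exact Or.inl (congrArg Subrepresentation.toSubmodule h)
      · exact Or.inr (congrArg Subrepresentation.toSubmodule h)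
  · rintro ⟨hV, h⟩
    have : Nontrivial (Subrepresentation ρ) := ⟨⊥, ⊤, fun e =>
      bot_ne_top (α := Submodule ℂ V) (congrArg Subrepresentation.toSubmodule e)⟩
    refine ⟨fun U => ?_⟩
    rcases h U.toSubmodule fun g v hv => U.apply_mem_toSubmodule g hv with h | h
    · exact Or.inl (Subrepresentation.toSubmodule_injective h)
    · exact Or.inr (Subrepresentation.toSubmodule_injective h)

/-- Lets isotypic components and coinduced spaces be used directly as models, although `IsIrredChar`
only speaks of `ℂ^d`. -/
theorem isIrredChar_character {G V : Type*} [Group G] [AddCommGroup V] [Module ℂ V]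
    [FiniteDimensional ℂ V] (ρ : Representation ℂ G V) (hρ : ρ.IsIrreducible) :
    IsIrredChar ρ.character := by
  let e : V ≃ₗ[ℂ] (Fin (Module.finrank ℂ V) → ℂ) := (Module.finBasis ℂ V).equivFun
  let σ : Representation ℂ G (Fin (Module.finrank ℂ V) → ℂ) :=
    { toFun := fun g => e.conj (ρ g)
      map_one' := by ext; simp
      map_mul' := fun g h => by ext; simp [LinearEquiv.conj_apply] }
  have hσ : ∀ g v, σ g v = e (ρ g (e.symm v)) := fun g v => rfl
  refine ⟨_, σ, ?_, ?_⟩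
  · rw [isIrreducible_iff] at hρ ⊢
    obtain ⟨hV, h⟩ := hρ
    refine ⟨e.symm.toEquiv.nontrivial, fun U hU => ?_⟩
    have := h (U.comap (e : V →ₗ[ℂ] _)) fun g v hv => by
      have := hU g _ hv
      simpa [hσ] using this
    rcases this with h0 | h0
    · left
      rw [eq_bot_iff] at h0 ⊢
      intro w hw
      have := h0 (show e.symm w ∈ _ by simpa using hw)
      simpa using this
    · right
      rw [eq_top_iff] at h0 ⊢
      intro w _
      have := h0 (show e.symm w ∈ ⊤ by trivial)
      simpa using this
  · ext g
    exact LinearMap.trace_conj' (ρ g) e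

theorem IsIrredChar.comp_mulEquiv {G H : Type*} [Group G] [Group H] (e : G ≃* H) {χ : H → ℂ}
    (hχ : IsIrredChar χ) : IsIrredChar (χ ∘ e) := by
  obtain ⟨d, ρ, hρ, rfl⟩ := hχ
  refine ⟨d, ρ.comp (e : G →* H), ?_, ?_⟩
  · rw [isIrreducible_iff] at hρ ⊢
    refine ⟨hρ.1, fun U hU => hρ.2 U fun g v hv => ?_⟩
    simpa using hU (e.symm g) v hv
  · ext g
    rfl

theorem numIrredChar_congr {G H : Type*} [Group G] [Group H] (e : G ≃* H) (k : ℕ) :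
    numIrredChar k G = numIrredChar k H := by
  refine Set.ncard_congr (fun χ _ => χ ∘ e.symm) ?_ ?_ ?_
  · rintro χ ⟨h, h1⟩
    exact ⟨h.comp_mulEquiv e.symm, by simpa using h1⟩
  · intro χ χ' _ _ h
    exact e.symm.surjective.injective_comp_right h
  · rintro χ ⟨h, h1⟩
    exact ⟨χ ∘ e, ⟨h.comp_mulEquiv e, by simpa using h1⟩, by ext; simp⟩

/-- By orthogonality the irreducible characters are linearly independent in the finite-dimensional
space of functions on `G`. Finiteness matters because `ncard` is `0` on infinite sets. -/
theorem finite_irredChar (G : Type*) [Group G] [Finite G] :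
    {χ : G → ℂ | IsIrredChar χ}.Finite := by
  classical
  have := Fintype.ofFinite G
  let B : (G → ℂ) → (G → ℂ) →ₗ[ℂ] ℂ := fun ψ =>
    { toFun := fun χ => ∑ g, χ g * ψ g⁻¹
      map_add' := fun a b => by simp [add_mul, Finset.sum_add_distrib]
      map_smul' := fun c a => by simp [Finset.mul_sum, mul_assoc] }
  have key : ∀ χ ψ : G → ℂ, IsIrredChar χ → IsIrredChar ψ →
      (χ ≠ ψ → B ψ χ = 0) ∧ (χ = ψ → B ψ χ ≠ 0) := by
    rintro _ _ ⟨d, ρ, hρ, rfl⟩ ⟨d', ρ', hρ', rfl⟩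
    have hG : (Nat.card G : ℂ) ≠ 0 := Nat.cast_ne_zero.mpr Nat.card_pos.ne'
    have : Invertible (Nat.card G : ℂ) := invertibleOfNonzero hG
    have h := Representation.char_orthonormal ρ ρ'
    have hB : B ρ'.character ρ.character = ∑ g, ρ.character g * ρ'.character g⁻¹ := rfl
    rw [← hB] at h
    refine ⟨fun hne => ?_, fun he h0 => ?_⟩
    · rw [if_neg] at h
      · exact (mul_eq_zero.mp h).resolve_left (inv_ne_zero hG)
      · rintro ⟨φ⟩
        exact hne (Representation.char_iso φ).symm
    · have h2 := Representation.char_orthonormal ρ ρ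
      rw [if_pos ⟨Representation.Equiv.refl ρ⟩] at h2
      rw [← he] at h0
      have hB2 : B ρ.character ρ.character = ∑ g, ρ.character g * ρ.character g⁻¹ := rfl
      rw [← hB2, h0, mul_zero] at h2
      exact zero_ne_one h2
  have hli : LinearIndependent ℂ (fun χ : {χ : G → ℂ | IsIrredChar χ} => (χ : G → ℂ)) := by
    rw [linearIndependent_iff']
    intro s c hc i hi
    have h1 : B i (∑ j ∈ s, c j • (j : G → ℂ)) = 0 := by rw [hc, map_zero]
    rw [map_sum, Finset.sum_eq_single_of_mem i hi] at h1
    · rw [map_smul, smul_eq_mul, mul_eq_zero] at h1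
      exact h1.resolve_right ((key _ _ i.2 i.2).2 rfl)
    · intro j _ hj
      rw [map_smul, (key _ _ j.2 i.2).1 (fun h => hj (Subtype.ext h)), smul_zero]
  have := hli.finite
  exact Set.toFinite _

/-- The base case of all later recursions. Every line is invariant under the trivial group, so
irreducibility forces dimension one. -/
theorem numIrredChar_of_subsingleton (G : Type*) [Group G] [Subsingleton G] (k : ℕ) :
    numIrredChar k G = if k = 1 then 1 else 0 := by
  have hdim : ∀ χ : G → ℂ, IsIrredChar χ → χ = fun _ => 1 := by
    rintro _ ⟨d, ρ, hρ, rfl⟩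
    obtain ⟨hV, h⟩ := (isIrreducible_iff ρ).mp hρ
    obtain ⟨v, hv⟩ := exists_ne (0 : Fin d → ℂ)
    have h1 : ∀ g : G, ρ g = 1 := fun g => by rw [Subsingleton.elim g 1, map_one]
    have hs := (h (Submodule.span ℂ {v}) fun g w hw => by simpa [h1] using hw).resolve_left
      (by simpa using hv)
    have hd : Module.finrank ℂ (Fin d → ℂ) = 1 := by
      rw [← finrank_top, ← hs, finrank_span_singleton hv]
    ext g
    rw [Subsingleton.elim g 1, Representation.char_one, hd, Nat.cast_one]
  have htriv : IsIrredChar (fun _ : G => (1 : ℂ)) := by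
    have : Representation.IsIrreducible (1 : Representation ℂ G ℂ) := by
      rw [isIrreducible_iff]
      exact ⟨inferInstance, fun U _ => eq_bot_or_eq_top U⟩
    convert isIrredChar_character _ this using 1
    ext g
    rw [Subsingleton.elim g 1, Representation.char_one]
    simp
  unfold numIrredChar
  split_ifs with hk
  · subst hk
    rw [Set.ncard_eq_one]
    refine ⟨fun _ => 1, Set.eq_singleton_iff_unique_mem.mpr ⟨⟨htriv, by simp⟩, ?_⟩⟩
    rintro χ ⟨h, -⟩
    exact hdim χ h
  · rw [Set.ncard_eq_zero ((finite_irredChar G).subset fun χ h => h.1)]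
    refine Set.eq_empty_of_forall_notMem ?_
    rintro χ ⟨h, h1⟩
    rw [hdim χ h] at h1
    have h2 : (1 : ℂ) = k := h1
    exact hk (by exact_mod_cast h2.symm)

end IrreducibleCharacters

/-! ### Decomposition under an abelian normal subgroup with a complement. -/

section LittleGroups

set_option linter.unusedSectionVars false

/-- `G` is the product of the normal subgroup `A` and its complement `H`, and the functions
`c x`, `x : X`, restrict to the linear characters of `A`, each occurring once, in such a way that
the action of `G` on `X` is the conjugation action on these characters. -/
structure IsDualAction {G X : Type*} [Group G] [Fintype X] [DecidableEq G]
    [DecidableEq X] [MulAction G X] (A H : Subgroup G) [Fintype A] (c : X → G → ℂ) : Prop where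
  normal : A.Normal
  map_one : ∀ x, c x 1 = 1
  map_mul : ∀ x, ∀ a ∈ A, ∀ b ∈ A, c x (a * b) = c x a * c x b
  -- The two orthogonality relations encode that `X` is the whole dual of `A`: this one makes the
  -- isotypic projections add up to the identity, the next makes them mutually orthogonal.
  sum_dual : ∀ a ∈ A, ∑ x, c x a = if a = 1 then (Nat.card A : ℂ) else 0
  sum_mul_inv : ∀ x y, ∑ a : A, c x a * c y (a : G)⁻¹ = if x = y then (Nat.card A : ℂ) else 0
  smul_conj : ∀ (g : G) x, ∀ a ∈ A, c (g • x) (g * a * g⁻¹) = c x a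
  smul_eq : ∀ a ∈ A, ∀ x : X, a • x = x
  exists_mul : ∀ g, ∃ a ∈ A, ∃ h ∈ H, g = a * h
  disjoint : ∀ g ∈ A, g ∈ H → g = 1

variable {G X : Type*} [Group G] [Fintype X] [DecidableEq G]
    [DecidableEq X] [MulAction G X] {A H : Subgroup G} [Fintype A] {c : X → G → ℂ}

theorem card_ne_zero {G : Type*} [Group G] (A : Subgroup G) [Finite A] : (Nat.card A : ℂ) ≠ 0 :=
  Nat.cast_ne_zero.mpr Nat.card_pos.ne'

theorem IsDualAction.mul_inv (h : IsDualAction A H c) (x : X) {a : G} (ha : a ∈ A) :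
    c x a * c x a⁻¹ = 1 := by
  rw [← h.map_mul x a ha _ (inv_mem ha), mul_inv_cancel, h.map_one]

theorem IsDualAction.sum_conj (h : IsDualAction A H c) {M : Type*} [AddCommMonoid M]
    (f : G → M) (g : G) : ∑ a : A, f (g * a * g⁻¹) = ∑ a : A, f a := by
  have := h.normal
  exact Fintype.sum_equiv (MulAut.conjNormal g : MulAut A).toEquiv _ _ fun a => by simp

variable (A c) in
/-- The `x`-isotypic part of a class function, with respect to `A`. -/
def isotypicPart (x : X) (χ : G → ℂ) (g : G) : ℂ :=
  (Nat.card A : ℂ)⁻¹ * ∑ a : A, c x (a : G)⁻¹ * χ (g * a)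

variable {V : Type*} [AddCommGroup V] [Module ℂ V] (ρ : Representation ℂ G V)

variable (A c) in
/-- The projection to the `x`-isotypic part of a representation, with respect to `A`. -/
def isotypicProj (x : X) : V →ₗ[ℂ] V :=
  (Nat.card A : ℂ)⁻¹ • ∑ a : A, c x (a : G)⁻¹ • ρ a

theorem isotypicProj_apply (x : X) (v : V) :
    isotypicProj A c ρ x v = (Nat.card A : ℂ)⁻¹ • ∑ a : A, c x (a : G)⁻¹ • ρ a v := by
  simp [isotypicProj]

variable (A c) in
/-- The `x`-isotypic part of a representation, with respect to `A`. -/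
def isotypicSubmodule (x : X) : Submodule ℂ V where
  carrier := {v | ∀ a ∈ A, ρ a v = c x a • v}
  add_mem' := fun {v w} hv hw a ha => by rw [_root_.map_add, hv a ha, hw a ha, smul_add]
  zero_mem' := fun a _ => by simp
  smul_mem' := fun r v hv a ha => by rw [_root_.map_smul, hv a ha, smul_comm]

theorem IsDualAction.isotypicProj_mem (h : IsDualAction A H c) (x : X) (v : V) :
    isotypicProj A c ρ x v ∈ isotypicSubmodule A c ρ x := by
  intro a ha
  rw [isotypicProj_apply, _root_.map_smul, smul_comm (c x a), map_sum]
  congr 1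
  rw [Finset.smul_sum]
  refine Fintype.sum_equiv (Equiv.mulLeft (⟨a, ha⟩ : A)) _ _ fun b => ?_
  have : c x a * c x (a * b : G)⁻¹ = c x (b : G)⁻¹ := by
    rw [mul_inv_rev, h.map_mul x _ (inv_mem b.2) _ (inv_mem ha), mul_left_comm, h.mul_inv x ha,
      mul_one]
  rw [mul_inv_rev] at this
  simp [smul_smul, this]

theorem IsDualAction.isotypicProj_of_mem (h : IsDualAction A H c) {x : X} (y : X) {v : V}
    (hv : v ∈ isotypicSubmodule A c ρ x) :
    isotypicProj A c ρ y v = if x = y then v else 0 := by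
  rw [isotypicProj_apply]
  have : ∀ a : A, c y (a : G)⁻¹ • ρ a v = (c x a * c y (a : G)⁻¹) • v := fun a => by
    rw [hv a a.2, smul_smul, mul_comm]
  simp_rw [this, ← Finset.sum_smul, h.sum_mul_inv]
  split_ifs
  · rw [smul_smul, inv_mul_cancel₀ (card_ne_zero A), one_smul]
  · simp

theorem IsDualAction.sum_isotypicProj (h : IsDualAction A H c) (v : V) :
    ∑ x, isotypicProj A c ρ x v = v := by
  simp_rw [isotypicProj_apply, ← Finset.smul_sum]
  rw [Finset.sum_comm]
  simp_rw [← Finset.sum_smul]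
  rw [Finset.sum_eq_single_of_mem (1 : A) (Finset.mem_univ _)]
  · rw [OneMemClass.coe_one, inv_one, h.sum_dual 1 (one_mem A), if_pos rfl, _root_.map_one,
      smul_smul, inv_mul_cancel₀ (card_ne_zero A), one_smul]
    rfl
  · intro a _ ha
    rw [h.sum_dual _ (inv_mem a.2), if_neg, zero_smul]
    simpa using ha

theorem IsDualAction.apply_isotypicProj (h : IsDualAction A H c) (x : X) (g : G) (v : V) :
    ρ g (isotypicProj A c ρ x v) = isotypicProj A c ρ (g • x) (ρ g v) := by
  rw [isotypicProj_apply, isotypicProj_apply, _root_.map_smul, map_sum]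
  congr 1
  rw [← h.sum_conj (fun a => c (g • x) a⁻¹ • ρ a (ρ g v)) g]
  refine Finset.sum_congr rfl fun a _ => ?_
  rw [conj_inv, h.smul_conj g x _ (inv_mem a.2), _root_.map_smul, ← Module.End.mul_apply,
    ← Module.End.mul_apply, ← _root_.map_mul, ← _root_.map_mul]
  simp

theorem IsDualAction.apply_mem (h : IsDualAction A H c) {x : X} (g : G) {v : V}
    (hv : v ∈ isotypicSubmodule A c ρ x) : ρ g v ∈ isotypicSubmodule A c ρ (g • x) := by
  have h1 := h.isotypicProj_of_mem ρ x hv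
  rw [if_pos rfl] at h1
  rw [← h1, h.apply_isotypicProj]
  exact h.isotypicProj_mem ρ _ _

theorem trace_mul_isotypicProj (x : X) (g : G) :
    LinearMap.trace ℂ V (ρ g * isotypicProj A c ρ x) = isotypicPart A c x ρ.character g := by
  simp [isotypicProj, isotypicPart, Finset.mul_sum, Representation.character]

theorem IsDualAction.sum_isotypicPart (h : IsDualAction A H c) (χ : G → ℂ) (g : G) :
    ∑ x, isotypicPart A c x χ g = χ g := by
  simp_rw [isotypicPart, ← Finset.mul_sum]
  rw [Finset.sum_comm]
  simp_rw [← Finset.sum_mul]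
  rw [Finset.sum_eq_single_of_mem (1 : A) (Finset.mem_univ _)]
  · rw [OneMemClass.coe_one, inv_one, h.sum_dual 1 (one_mem A), if_pos rfl, ← mul_assoc,
      inv_mul_cancel₀ (card_ne_zero A), one_mul, mul_one]
  · intro a _ ha
    rw [h.sum_dual _ (inv_mem a.2), if_neg, zero_mul]
    simpa using ha

/-- With `p` the projection to the `x`-part, `tr (ρ g p) = tr (ρ g p p) = tr (p ρ g p)`, and `p ρ g
p = 0` because `ρ g` moves the `x`-part to the different `g • x`-part. -/
theorem IsDualAction.isotypicPart_of_smul_ne (h : IsDualAction A H c) {x : X} {g : G}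
    (hx : g • x ≠ x) : isotypicPart A c x ρ.character g = 0 := by
  have h1 : ρ g * isotypicProj A c ρ x =
      (ρ g * isotypicProj A c ρ x) * isotypicProj A c ρ x := by
    ext v
    simp [h.isotypicProj_of_mem ρ x (h.isotypicProj_mem ρ x v)]
  rw [← trace_mul_isotypicProj, h1, LinearMap.trace_mul_comm]
  convert _root_.map_zero (LinearMap.trace ℂ V)
  ext v
  simp [h.isotypicProj_of_mem ρ x (h.apply_mem ρ g (h.isotypicProj_mem ρ x v)), hx]

theorem IsDualAction.isotypicPart_conj (h : IsDualAction A H c) (x : X) (k g : G) :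
    isotypicPart A c (k • x) ρ.character (k * g * k⁻¹) = isotypicPart A c x ρ.character g := by
  rw [isotypicPart, isotypicPart,
    ← h.sum_conj (fun a => c (k • x) a⁻¹ * ρ.character (k * g * k⁻¹ * a)) k]
  congr 1
  refine Finset.sum_congr rfl fun a _ => ?_
  rw [conj_inv, h.smul_conj k x _ (inv_mem a.2), ← ρ.char_conj (g * a) k]
  congr 2
  group

theorem IsDualAction.isotypicPart_mul (h : IsDualAction A H c) (x : X) {b : G} (hb : b ∈ A)
    (g : G) :
    isotypicPart A c x ρ.character (g * b) = c x b * isotypicPart A c x ρ.character g := by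
  rw [← trace_mul_isotypicProj, ← trace_mul_isotypicProj, ← smul_eq_mul (c x b),
    ← _root_.map_smul]
  congr 1
  ext v
  simp [(h.isotypicProj_mem ρ x v) b hb]

end LittleGroups

/-! ### From an irreducible representation to its isotypic part. -/

section LittleGroupsIrreducible

set_option linter.unusedSectionVars false

open MulAction (stabilizer orbit)

variable {G X : Type*} [Group G] [Fintype X] [DecidableEq G]
    [DecidableEq X] [MulAction G X] {A H : Subgroup G} [Fintype A] {c : X → G → ℂ}
    {V : Type*} [AddCommGroup V] [Module ℂ V]

/-- The action of the stabilizer of `x` in the complement of `A` on the `x`-isotypic part. -/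
def IsDualAction.isotypicRep (h : IsDualAction A H c) (ρ : Representation ℂ G V) (x : X) :
    Representation ℂ ↥(stabilizer G x ⊓ H) (isotypicSubmodule A c ρ x) where
  toFun s := (ρ s).restrict fun v hv => by
    have h1 := h.apply_mem ρ (s : G) hv
    rwa [s.2.1] at h1
  map_one' := by ext; simp
  map_mul' s t := by ext; simp

variable (ρ : Representation ℂ G V)

theorem IsDualAction.coe_isotypicRep (h : IsDualAction A H c) (x : X)
    (s : ↥(stabilizer G x ⊓ H)) (v : isotypicSubmodule A c ρ x) :
    (h.isotypicRep ρ x s v : V) = ρ s v := rfl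

theorem IsDualAction.isotypicProj_eq_self (h : IsDualAction A H c) {x : X} {v : V}
    (hv : v ∈ isotypicSubmodule A c ρ x) : isotypicProj A c ρ x v = v := by
  rw [h.isotypicProj_of_mem ρ x hv, if_pos rfl]

/-- `ρ s` composed with the projection has its image in the `x`-part, so its trace can be computed
there, where the projection is the identity. -/
theorem IsDualAction.character_isotypicRep [FiniteDimensional ℂ V] (h : IsDualAction A H c) (x : X)
    (s : ↥(stabilizer G x ⊓ H)) :
    (h.isotypicRep ρ x).character s = isotypicPart A c x ρ.character s := by
  rw [← trace_mul_isotypicProj, Representation.character]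
  have hmem : ∀ v, (ρ s * isotypicProj A c ρ x) v ∈ isotypicSubmodule A c ρ x := fun v =>
    (h.isotypicRep ρ x s ⟨_, h.isotypicProj_mem ρ x v⟩).2
  rw [← LinearMap.trace_restrict_eq_of_forall_mem _ _ hmem]
  congr 1
  ext v
  simp [h.coe_isotypicRep, h.isotypicProj_eq_self ρ v.2]

theorem IsDualAction.apply_of_stabilizer (h : IsDualAction A H c) (x : X) {g : G}
    (hg : g • x = x) :
    ∃ a ∈ A, ∃ s : ↥(stabilizer G x ⊓ H), g = a * s := by
  obtain ⟨a, ha, k, hk, rfl⟩ := h.exists_mul g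
  rw [mul_smul, h.smul_eq a ha] at hg
  exact ⟨a, ha, ⟨k, hg, hk⟩, rfl⟩

theorem IsDualAction.isIrreducible_isotypicRep (h : IsDualAction A H c) (x : X)
    (hρ : ρ.IsIrreducible) (hx : isotypicSubmodule A c ρ x ≠ ⊥) :
    (h.isotypicRep ρ x).IsIrreducible := by
  rw [isIrreducible_iff] at hρ ⊢
  refine ⟨Submodule.nontrivial_iff_ne_bot.mpr hx, fun W hW => ?_⟩
  -- The vectors all of whose translates project into `W`. This space is `G`-invariant and meets the
  -- `x`-part exactly in `W`, so `U = ⊥` gives `W = ⊥` and `U = ⊤` gives `W = ⊤`.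
  let U : Submodule ℂ V := ⨅ g : G, (W.map (isotypicSubmodule A c ρ x).subtype).comap
    (isotypicProj A c ρ x * ρ g)
  have hU : ∀ v, v ∈ U ↔ ∀ g, isotypicProj A c ρ x (ρ g v) ∈
      W.map (isotypicSubmodule A c ρ x).subtype := by
    intro v
    simp [U, Submodule.mem_iInf]
  rcases hρ.2 U fun g v hv => by
    rw [hU] at hv ⊢
    intro k
    simpa using hv (k * g) with h0 | h0
  · left
    rw [eq_bot_iff]
    intro w hw
    have : (w : V) ∈ U := by
      rw [hU]
      intro g
      by_cases hg : g • x = x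
      · obtain ⟨a, ha, s, rfl⟩ := h.apply_of_stabilizer x hg
        have h1 := h.apply_mem ρ (a * s) w.2
        rw [hg] at h1
        rw [h.isotypicProj_eq_self ρ h1]
        refine ⟨c x a • h.isotypicRep ρ x s w, W.smul_mem _ (hW s w hw), ?_⟩
        rw [Submodule.subtype_apply, Submodule.coe_smul,
          ← (h.isotypicRep ρ x s w).2 a ha, h.coe_isotypicRep]
        simp
      · rw [h.isotypicProj_of_mem ρ x (h.apply_mem ρ g w.2), if_neg hg]
        exact zero_mem _
    rw [h0] at this
    simpa using this
  · right
    rw [eq_top_iff]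
    intro w _
    have : (w : V) ∈ U := h0 ▸ Submodule.mem_top
    rw [hU] at this
    have h1 := this 1
    rw [_root_.map_one, Module.End.one_apply, h.isotypicProj_eq_self ρ w.2] at h1
    obtain ⟨w', hw', he⟩ := h1
    rwa [Subtype.ext he.symm]

theorem IsDualAction.mem_orbit_of_ne_bot (h : IsDualAction A H c) {x y : X}
    (hρ : ρ.IsIrreducible) (hx : isotypicSubmodule A c ρ x ≠ ⊥)
    (hy : isotypicSubmodule A c ρ y ≠ ⊥) : y ∈ orbit G x := by
  rw [isIrreducible_iff] at hρ
  by_contra hxy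
  -- An invariant subspace of vectors whose translates have no `y`-component. If `y` is outside the
  -- orbit of `x` it contains the `x`-part, and it never contains a nonzero `y`-part.
  let U : Submodule ℂ V := ⨅ g : G, LinearMap.ker (isotypicProj A c ρ y * ρ g)
  have hU : ∀ v, v ∈ U ↔ ∀ g, isotypicProj A c ρ y (ρ g v) = 0 := by
    intro v
    simp [U, Submodule.mem_iInf]
  rcases hρ.2 U fun g v hv => by
    rw [hU] at hv ⊢
    intro k
    simpa using hv (k * g) with h0 | h0
  · refine hx (eq_bot_iff.mpr fun v hv => ?_)
    rw [← h0, hU]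
    intro g
    rw [h.isotypicProj_of_mem ρ y (h.apply_mem ρ g hv), if_neg]
    rintro rfl
    exact hxy ⟨g, rfl⟩
  · refine hy (eq_bot_iff.mpr fun v hv => ?_)
    have : v ∈ U := h0 ▸ Submodule.mem_top
    rw [hU] at this
    have h1 := this 1
    rw [_root_.map_one, Module.End.one_apply, h.isotypicProj_eq_self ρ hv] at h1
    exact h1

theorem IsDualAction.exists_isotypicSubmodule_ne_bot (h : IsDualAction A H c)
    (hρ : ρ.IsIrreducible) : ∃ x, isotypicSubmodule A c ρ x ≠ ⊥ := by
  rw [isIrreducible_iff] at hρ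
  obtain ⟨v, hv⟩ := @exists_ne V hρ.1 0
  by_contra! h0
  refine hv ?_
  rw [← h.sum_isotypicProj ρ v]
  refine Finset.sum_eq_zero fun x _ => ?_
  have := h.isotypicProj_mem ρ x v
  rwa [h0 x, Submodule.mem_bot] at this

theorem IsDualAction.isotypicSubmodule_smul_ne_bot (h : IsDualAction A H c) {x : X} (g : G)
    (hx : isotypicSubmodule A c ρ x ≠ ⊥) : isotypicSubmodule A c ρ (g • x) ≠ ⊥ := by
  obtain ⟨v, hv, hv0⟩ := (Submodule.ne_bot_iff _).mp hx
  refine (Submodule.ne_bot_iff _).mpr ⟨ρ g v, h.apply_mem ρ g hv, fun h0 => hv0 ?_⟩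
  have : ρ g⁻¹ (ρ g v) = v := by rw [← Module.End.mul_apply, ← _root_.map_mul]; simp
  rw [← this, h0, _root_.map_zero]

theorem IsDualAction.isotypicPart_one [FiniteDimensional ℂ V] (h : IsDualAction A H c) (x : X) :
    isotypicPart A c x ρ.character 1 = Module.finrank ℂ (isotypicSubmodule A c ρ x) := by
  rw [← Representation.char_one (h.isotypicRep ρ x), h.character_isotypicRep]
  simp

theorem IsDualAction.isotypicPart_one_ne_zero [FiniteDimensional ℂ V] (h : IsDualAction A H c)
    (x : X) : isotypicPart A c x ρ.character 1 ≠ 0 ↔ isotypicSubmodule A c ρ x ≠ ⊥ := by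
  rw [h.isotypicPart_one, Ne, Nat.cast_eq_zero, Submodule.finrank_eq_zero]

/-- The space is the sum of the isotypic parts over one orbit, and conjugation shows that these all
have the same dimension. -/
theorem IsDualAction.character_one [FiniteDimensional ℂ V] (h : IsDualAction A H c) (x : X)
    (hρ : ρ.IsIrreducible) (hx : isotypicSubmodule A c ρ x ≠ ⊥) :
    ρ.character 1 = Nat.card (orbit G x) * isotypicPart A c x ρ.character 1 := by
  classical
  rw [← h.sum_isotypicPart ρ.character 1]
  have h1 : ∀ y, isotypicPart A c y ρ.character 1 =
      if y ∈ orbit G x then isotypicPart A c x ρ.character 1 else 0 := by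
    intro y
    split_ifs with hy
    · obtain ⟨g, rfl⟩ := hy
      have h2 := h.isotypicPart_conj ρ x g 1
      rwa [mul_one, mul_inv_cancel] at h2
    · by_contra h0
      exact hy (h.mem_orbit_of_ne_bot ρ hρ hx ((h.isotypicPart_one_ne_zero ρ y).mp h0))
  rw [Finset.sum_congr rfl fun y _ => h1 y, ← Finset.sum_filter, Finset.sum_const, nsmul_eq_mul,
    Nat.card_eq_fintype_card,
    Fintype.card_subtype]

/-- An irreducible character is determined by its isotypic part for a character of `A` that
occurs in it. -/
theorem IsDualAction.character_ext (h : IsDualAction A H c) (x : X) {χ χ' : G → ℂ}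
    (hχ : IsIrredChar χ) (hχ' : IsIrredChar χ')
    (hx : isotypicPart A c x χ 1 ≠ 0)
    (he : ∀ s ∈ stabilizer G x ⊓ H, isotypicPart A c x χ s = isotypicPart A c x χ' s) :
    χ = χ' := by
  have hx' : isotypicPart A c x χ' 1 ≠ 0 := by rwa [← he 1 (one_mem _)]
  obtain ⟨d, ρ, hρ, rfl⟩ := hχ
  obtain ⟨d', ρ', hρ', rfl⟩ := hχ'
  rw [h.isotypicPart_one_ne_zero] at hx hx'
  ext g
  rw [← h.sum_isotypicPart ρ.character g, ← h.sum_isotypicPart ρ'.character g]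
  -- Parts at `y` not fixed by `g` have trace zero, and those off the orbit of `x` vanish. A part at
  -- `k • x` fixed by `g` is conjugated back to `x`.
  refine Finset.sum_congr rfl fun y _ => ?_
  by_cases hgy : g • y = y
  swap
  · rw [h.isotypicPart_of_smul_ne ρ hgy, h.isotypicPart_of_smul_ne ρ' hgy]
  by_cases hy : y ∈ orbit G x
  · obtain ⟨k, rfl⟩ := hy
    have hk : (k⁻¹ * g * k) • x = x := by
      rw [mul_smul, mul_smul]
      exact inv_smul_eq_iff.mpr hgy
    have hgk : g = k * (k⁻¹ * g * k) * k⁻¹ := by group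
    rw [hgk]
    change isotypicPart A c (k • x) _ _ = isotypicPart A c (k • x) _ _
    rw [h.isotypicPart_conj, h.isotypicPart_conj]
    obtain ⟨a, ha, s, hs⟩ := h.apply_of_stabilizer x hk
    have hn := h.normal
    -- The factor from `A` is moved to the right, where it acts by the scalar `c x`.
    have hs' : (k⁻¹ * g * k) = s * (s⁻¹ * a * s : G) := by rw [hs]; simp [mul_assoc]
    have hb : (s⁻¹ * a * s : G) ∈ A := by simpa using hn.conj_mem a ha (s⁻¹ : G)
    rw [hs', h.isotypicPart_mul ρ x hb, h.isotypicPart_mul ρ' x hb, he _ s.2]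
  · have key : ∀ {n : ℕ} (τ : Representation ℂ G (Fin n → ℂ)), τ.IsIrreducible →
        isotypicSubmodule A c τ x ≠ ⊥ → isotypicPart A c y τ.character g = 0 := by
      intro n τ hτ hτx
      have h0 : isotypicSubmodule A c τ y = ⊥ := by
        by_contra h1
        exact hy (h.mem_orbit_of_ne_bot τ hτ hτx h1)
      rw [← trace_mul_isotypicProj]
      convert _root_.map_zero (LinearMap.trace ℂ (Fin n → ℂ))
      refine LinearMap.ext fun v => ?_
      have h1 := h.isotypicProj_mem τ y v
      rw [h0, Submodule.mem_bot] at h1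
      rw [Module.End.mul_apply, h1, _root_.map_zero, LinearMap.zero_apply]
    rw [key ρ hρ hx, key ρ' hρ' hx']

end LittleGroupsIrreducible

/-! ### From a representation of the stabilizer to an irreducible representation of `G`. -/

section LittleGroupsInduction

set_option linter.unusedSectionVars false

open MulAction (stabilizer orbit)

variable {G X : Type*} [Group G] [Fintype X] [DecidableEq G]
    [DecidableEq X] [MulAction G X] {A H : Subgroup G} [Fintype A] {c : X → G → ℂ}
    {W : Type*} [AddCommGroup W] [Module ℂ W]

/-- `G` is the semidirect product of `A` and `H`; the `H`-component is unique because `A ∩ H = 1`,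
and multiplicative because `A` is normal. -/
theorem IsDualAction.exists_retraction (h : IsDualAction A H c) :
    ∃ π : G →* G, (∀ g, π g ∈ H) ∧ (∀ g, g * (π g)⁻¹ ∈ A) ∧ ∀ s ∈ H, π s = s := by
  have hn := h.normal
  have hex : ∀ g : G, ∃ k ∈ H, g * k⁻¹ ∈ A := fun g => by
    obtain ⟨a, ha, k, hk, rfl⟩ := h.exists_mul g
    exact ⟨k, hk, by simpa using ha⟩
  have huniq : ∀ g k k', k ∈ H → k' ∈ H → g * k⁻¹ ∈ A → g * k'⁻¹ ∈ A → k = k' := by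
    intro g k k' hk hk' h1 h2
    have h3 : k * k'⁻¹ ∈ A := by
      have := mul_mem (inv_mem h1) h2
      simpa [mul_assoc] using this
    have := h.disjoint _ h3 (mul_mem hk (inv_mem hk'))
    exact mul_inv_eq_one.mp this
  choose π hπH hπA using hex
  refine ⟨MonoidHom.mk' π fun g g' => ?_, hπH, hπA, fun s hs => ?_⟩
  · refine huniq (g * g') _ _ (hπH _) (mul_mem (hπH _) (hπH _)) (hπA _) ?_
    have := mul_mem (hn.conj_mem _ (hπA g') g) (hπA g)
    simpa [mul_assoc] using this
  · exact huniq s _ _ (hπH s) hs (hπA s) (by simp)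

/-- The projection onto the complement `H` along the normal subgroup `A`. -/
def IsDualAction.retraction (h : IsDualAction A H c) : G →* G := h.exists_retraction.choose

theorem IsDualAction.retraction_mem (h : IsDualAction A H c) (g : G) : h.retraction g ∈ H :=
  h.exists_retraction.choose_spec.1 g

theorem IsDualAction.mul_retraction_inv_mem (h : IsDualAction A H c) (g : G) :
    g * (h.retraction g)⁻¹ ∈ A :=
  h.exists_retraction.choose_spec.2.1 g

theorem IsDualAction.retraction_of_mem (h : IsDualAction A H c) {s : G} (hs : s ∈ H) :
    h.retraction s = s :=
  h.exists_retraction.choose_spec.2.2 s hs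

theorem IsDualAction.retraction_eq_one (h : IsDualAction A H c) {a : G} (ha : a ∈ A) :
    h.retraction a = 1 := by
  refine h.disjoint _ ?_ (h.retraction_mem a)
  have := mul_mem (inv_mem (h.mul_retraction_inv_mem a)) ha
  simpa using this

theorem IsDualAction.retraction_smul (h : IsDualAction A H c) (g : G) (x : X) :
    h.retraction g • x = g • x := by
  have : g = (g * (h.retraction g)⁻¹) * h.retraction g := by simp
  conv_rhs => rw [this, mul_smul, h.smul_eq _ (h.mul_retraction_inv_mem g)]

/-- The extension of a representation of the stabilizer of `x` in the complement `H` to the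
whole stabilizer of `x`, such that `A` acts via `c x`. -/
def IsDualAction.extRep (h : IsDualAction A H c) {x : X}
    (σ : Representation ℂ ↥(stabilizer G x ⊓ H) W) : Representation ℂ (stabilizer G x) W where
  toFun b := c x (b * (h.retraction b)⁻¹) •
    σ ⟨h.retraction b, (h.retraction_smul b x).trans b.2, h.retraction_mem b⟩
  map_one' := by
    ext w
    simp only [OneMemClass.coe_one, _root_.map_one, inv_one, mul_one, h.map_one, one_smul]
    exact congrFun (congrArg DFunLike.coe (_root_.map_one σ)) w
  map_mul' b b' := by
    have hn := h.normal
    -- The `A`-component of `b b'` is the conjugate by `b` of that of `b'`, times that of `b`. Since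
    -- `b` fixes `x`, the conjugation does not change the value of `c x`.
    have h1 : ((b * b' : stabilizer G x) : G) * (h.retraction (b * b' : stabilizer G x))⁻¹ =
        (b * (b' * (h.retraction b')⁻¹) * (b : G)⁻¹) * (b * (h.retraction b)⁻¹) := by
      simp [mul_assoc]
    have h2 : c x (b * (b' * (h.retraction b')⁻¹) * (b : G)⁻¹) =
        c x (b' * (h.retraction b')⁻¹) := by
      have := h.smul_conj b x _ (h.mul_retraction_inv_mem b')
      rwa [show (b : G) • x = x from b.2] at this
    rw [h1, h.map_mul x _ (hn.conj_mem _ (h.mul_retraction_inv_mem b') _) _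
      (h.mul_retraction_inv_mem b), h2, smul_mul_smul_comm, ← _root_.map_mul, mul_comm (c x _)]
    congr 2
    ext
    simp

variable {x : X} (σ : Representation ℂ ↥(stabilizer G x ⊓ H) W)

theorem IsDualAction.extRep_of_mem (h : IsDualAction A H c) {a : G} (ha : a ∈ A) (w : W) :
    h.extRep σ ⟨a, h.smul_eq a ha x⟩ w = c x a • w := by
  have h1 : (⟨h.retraction a, (h.retraction_smul a x).trans (h.smul_eq a ha x),
      h.retraction_mem a⟩ : ↥(stabilizer G x ⊓ H)) = 1 := Subtype.ext (h.retraction_eq_one ha)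
  change (c x (a * (h.retraction a)⁻¹) • σ _) w = _
  rw [h1, _root_.map_one, h.retraction_eq_one ha]
  simp

theorem IsDualAction.extRep_of_complement (h : IsDualAction A H c)
    (s : ↥(stabilizer G x ⊓ H)) (w : W) : h.extRep σ ⟨s, s.2.1⟩ w = σ s w := by
  have h1 : (⟨h.retraction s, (h.retraction_smul s x).trans s.2.1,
      h.retraction_mem s⟩ : ↥(stabilizer G x ⊓ H)) = s :=
    Subtype.ext (h.retraction_of_mem s.2.2)
  change (c x (s * (h.retraction s)⁻¹) • σ _) w = _
  rw [h1, h.retraction_of_mem s.2.2, mul_inv_cancel, h.map_one, one_smul]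

/-- The representation of `G` induced from the extension of `σ` to the stabilizer of `x`. -/
abbrev IsDualAction.indRep (h : IsDualAction A H c) :
    Representation ℂ G (Representation.coindV (stabilizer G x).subtype (h.extRep σ)) :=
  Representation.coind (stabilizer G x).subtype (h.extRep σ)

theorem IsDualAction.indRep_apply (h : IsDualAction A H c) (g k : G)
    (f : Representation.coindV (stabilizer G x).subtype (h.extRep σ)) :
    (h.indRep σ g f : G → W) k = (f : G → W) (k * g) := rfl

theorem IsDualAction.coindV_apply (h : IsDualAction A H c)
    (f : Representation.coindV (stabilizer G x).subtype (h.extRep σ)) {b : G} (hb : b • x = x)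
    (g : G) : (f : G → W) (b * g) = h.extRep σ ⟨b, hb⟩ ((f : G → W) g) :=
  f.2 ⟨b, hb⟩ g

theorem IsDualAction.indRep_of_mem (h : IsDualAction A H c) {a : G} (ha : a ∈ A) (g : G)
    (f : Representation.coindV (stabilizer G x).subtype (h.extRep σ)) :
    (h.indRep σ a f : G → W) g = c (g⁻¹ • x) a • (f : G → W) g := by
  have hn := h.normal
  have h1 : g * a = (g * a * g⁻¹) * g := by simp
  have hm := hn.conj_mem a ha g
  rw [h.indRep_apply, h1, h.coindV_apply σ f (h.smul_eq _ hm x), h.extRep_of_mem σ hm]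
  have := h.smul_conj g (g⁻¹ • x) a ha
  rw [smul_inv_smul] at this
  rw [this]

theorem IsDualAction.isotypicProj_indRep (h : IsDualAction A H c) (y : X) (g : G)
    (f : Representation.coindV (stabilizer G x).subtype (h.extRep σ)) :
    (isotypicProj A c (h.indRep σ) y f : G → W) g = if g⁻¹ • x = y then (f : G → W) g else 0 := by
  rw [isotypicProj_apply]
  simp only [Submodule.coe_smul, Submodule.coe_sum, Pi.smul_apply, Finset.sum_apply]
  have : ∀ a : A, c y (a : G)⁻¹ • (h.indRep σ a f : G → W) g =
      (c (g⁻¹ • x) a * c y (a : G)⁻¹) • (f : G → W) g := fun a => by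
    rw [h.indRep_of_mem σ a.2, smul_smul, mul_comm]
  rw [Finset.sum_congr rfl fun a _ => this a, ← Finset.sum_smul, h.sum_mul_inv]
  split_ifs
  · rw [smul_smul, inv_mul_cancel₀ (card_ne_zero A), one_smul]
  · simp

/-- On the value `f g` the group `A` acts through the character `g⁻¹ • x`, so the `x`-part consists
of the functions supported on the stabilizer of `x`. -/
theorem IsDualAction.mem_isotypicSubmodule_indRep (h : IsDualAction A H c)
    (f : Representation.coindV (stabilizer G x).subtype (h.extRep σ)) :
    f ∈ isotypicSubmodule A c (h.indRep σ) x ↔ ∀ g, g • x ≠ x → (f : G → W) g = 0 := by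
  have hg : ∀ g : G, g⁻¹ • x = x ↔ g • x = x := fun g => by
    rw [inv_smul_eq_iff, eq_comm]
  constructor
  · intro hf g hgx
    rw [← h.isotypicProj_eq_self (h.indRep σ) hf, h.isotypicProj_indRep, if_neg]
    rwa [hg]
  · intro hf
    have : f = isotypicProj A c (h.indRep σ) x f := by
      ext g
      rw [h.isotypicProj_indRep]
      split_ifs with h1
      · rfl
      · exact hf g (by rwa [hg] at h1)
    rw [this]
    exact h.isotypicProj_mem _ _ _

/-- Evaluation at `1` identifies the `x`-isotypic part of the induced representation. -/
def IsDualAction.evalOne (h : IsDualAction A H c) :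
    isotypicSubmodule A c (h.indRep σ) x →ₗ[ℂ] W :=
  LinearMap.proj 1 ∘ₗ Submodule.subtype _ ∘ₗ Submodule.subtype _

theorem IsDualAction.evalOne_apply (h : IsDualAction A H c)
    (f : isotypicSubmodule A c (h.indRep σ) x) : h.evalOne σ f = (f.1 : G → W) 1 := rfl

/-- By equivariance, a function supported on the stabilizer is determined by its value at `1`, and
this value is arbitrary. -/
theorem IsDualAction.evalOne_bijective (h : IsDualAction A H c) :
    Function.Bijective (h.evalOne σ) := by
  classical
  constructor
  · rw [injective_iff_map_eq_zero]
    intro f hf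
    ext g
    by_cases hg : g • x = x
    · have := h.coindV_apply σ f.1 hg 1
      rw [mul_one] at this
      rw [this]
      rw [h.evalOne_apply] at hf
      rw [hf, _root_.map_zero]
      rfl
    · exact (h.mem_isotypicSubmodule_indRep σ f.1).mp f.2 g hg
  · intro w
    let f : Representation.coindV (stabilizer G x).subtype (h.extRep σ) :=
      ⟨fun g => if hg : g • x = x then h.extRep σ ⟨g, hg⟩ w else 0, by
        intro b g
        have hb : (b : G) • x = x := b.2
        by_cases hg : g • x = x
        · have hbg : ((b : G) * g) • x = x := by rw [mul_smul, hg, hb]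
          refine (dif_pos hbg).trans (Eq.trans ?_ (congrArg _ (dif_pos hg).symm))
          rw [← Module.End.mul_apply, ← _root_.map_mul]
          rfl
        · have hbg : ((b : G) * g) • x ≠ x := by
            rw [mul_smul]
            intro h1
            refine hg ?_
            have h2 : (b : G)⁻¹ • x = x := inv_smul_eq_iff.mpr hb.symm
            have h3 := congrArg ((b : G)⁻¹ • ·) h1
            simpa [h2] using h3
          refine (dif_neg hbg).trans (Eq.trans ?_ (congrArg _ (dif_neg hg).symm))
          rw [_root_.map_zero]⟩
    have hf : f ∈ isotypicSubmodule A c (h.indRep σ) x := by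
      rw [h.mem_isotypicSubmodule_indRep]
      intro g hg
      exact dif_neg hg
    refine ⟨⟨f, hf⟩, ?_⟩
    rw [h.evalOne_apply]
    have h1 : (1 : G) • x = x := one_smul G x
    change (if hg : (1 : G) • x = x then h.extRep σ ⟨1, hg⟩ w else 0) = w
    rw [dif_pos h1]
    exact congrFun (congrArg DFunLike.coe (_root_.map_one (h.extRep σ))) w

theorem IsDualAction.evalOne_isotypicRep (h : IsDualAction A H c) (s : ↥(stabilizer G x ⊓ H))
    (f : isotypicSubmodule A c (h.indRep σ) x) :
    h.evalOne σ (h.isotypicRep (h.indRep σ) x s f) = σ s (h.evalOne σ f) := by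
  rw [h.evalOne_apply, h.evalOne_apply, h.coe_isotypicRep, h.indRep_apply, one_mul,
    ← h.extRep_of_complement, ← h.coindV_apply σ f.1 s.2.1, mul_one]

theorem IsDualAction.isotypicPart_indRep [Finite G] [FiniteDimensional ℂ W]
    (h : IsDualAction A H c) (s : ↥(stabilizer G x ⊓ H)) :
    isotypicPart A c x (h.indRep σ).character s = σ.character s := by
  rw [← h.character_isotypicRep, Representation.character, Representation.character]
  refine (LinearMap.trace_conj' (R := ℂ) (M := isotypicSubmodule A c (h.indRep σ) x) (N := W)
    (h.isotypicRep (h.indRep σ) x s)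
    (LinearEquiv.ofBijective (h.evalOne σ) (h.evalOne_bijective σ))).symm.trans ?_
  congr 1
  ext w
  obtain ⟨f, rfl⟩ := (h.evalOne_bijective σ).2 w
  rw [LinearEquiv.conj_apply_apply]
  have : (LinearEquiv.ofBijective (h.evalOne σ) (h.evalOne_bijective σ)).symm (h.evalOne σ f) = f := by
    rw [LinearEquiv.symm_apply_eq]
    rfl
  rw [this, ← h.evalOne_isotypicRep]
  rfl

/-- A nonzero invariant `U` contains a function with `f 1 ≠ 0`, after translation. Its projection is
a nonzero element of the `x`-part in `U`, so by irreducibility of `σ` the whole `x`-part lies in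
`U`. Its translates are all the nonzero isotypic parts. -/
theorem IsDualAction.isIrreducible_indRep (h : IsDualAction A H c) (hσ : σ.IsIrreducible) :
    (h.indRep σ).IsIrreducible := by
  have hsurj := (h.evalOne_bijective σ).2
  have hinj := (h.evalOne_bijective σ).1
  rw [isIrreducible_iff] at hσ ⊢
  obtain ⟨hW, hσ⟩ := hσ
  constructor
  · obtain ⟨w, hw⟩ := exists_ne (0 : W)
    obtain ⟨f, rfl⟩ := hsurj w
    exact ⟨f, 0, fun h0 => hw (by rw [(Subtype.ext h0 : f = 0), _root_.map_zero])⟩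
  intro U hU
  by_cases hU0 : U = ⊥
  · exact Or.inl hU0
  right
  have hproj : ∀ y, ∀ f ∈ U, isotypicProj A c (h.indRep σ) y f ∈ U := fun y f hf => by
    rw [isotypicProj_apply]
    exact U.smul_mem _ (U.sum_mem fun a _ => U.smul_mem _ (hU _ _ hf))
  have hle : isotypicSubmodule A c (h.indRep σ) x ≤ U := by
    rcases hσ ((U.comap (isotypicSubmodule A c (h.indRep σ) x).subtype).map (h.evalOne σ))
      (by
        rintro s _ ⟨f, hf, rfl⟩
        exact ⟨h.isotypicRep (h.indRep σ) x s f, hU s _ hf, h.evalOne_isotypicRep σ s f⟩)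
      with h0 | h0
    · exfalso
      obtain ⟨f, hf, hf0⟩ := (Submodule.ne_bot_iff _).mp hU0
      refine hf0 ?_
      ext g
      have h1 : h.evalOne σ ⟨_, h.isotypicProj_mem (h.indRep σ) x (h.indRep σ g f)⟩ = 0 := by
        rw [← Submodule.mem_bot ℂ, ← h0]
        exact ⟨_, hproj x _ (hU g f hf), rfl⟩
      rw [h.evalOne_apply] at h1
      rw [h.isotypicProj_indRep, inv_one, one_smul, if_pos rfl, h.indRep_apply, one_mul] at h1
      exact h1
    · intro f hf
      have : h.evalOne σ ⟨f, hf⟩ ∈ (⊤ : Submodule ℂ W) := Submodule.mem_top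
      rw [← h0] at this
      obtain ⟨f', hf', he⟩ := this
      have := hinj he
      rw [this] at hf'
      exact hf'
  rw [eq_top_iff]
  intro f _
  rw [← h.sum_isotypicProj (h.indRep σ) f]
  refine U.sum_mem fun y _ => ?_
  by_cases hy : y ∈ orbit G x
  · obtain ⟨g, hg⟩ := hy
    have h1 := h.apply_mem (h.indRep σ) g⁻¹ (h.isotypicProj_mem (h.indRep σ) y f)
    rw [← hg] at h1
    simp only [inv_smul_smul] at h1
    have h2 := hU g _ (hle h1)
    rw [← Module.End.mul_apply, ← _root_.map_mul, mul_inv_cancel, _root_.map_one] at h2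
    rw [← hg]
    exact h2
  · have : isotypicProj A c (h.indRep σ) y f = 0 := by
      ext g
      rw [h.isotypicProj_indRep, if_neg]
      · rfl
      · rintro rfl
        exact hy ⟨g⁻¹, rfl⟩
    rw [this]
    exact zero_mem U

end LittleGroupsInduction

/-! ### The Clifford correspondence and the counting formula. -/

section LittleGroupsCount

set_option linter.unusedSectionVars false

open MulAction (stabilizer orbit)

variable {G X : Type*} [Group G] [Finite G] [Fintype X] [DecidableEq G]
    [DecidableEq X] [MulAction G X] {A H : Subgroup G} [Fintype A] {c : X → G → ℂ}

/-- The bijection sends `χ` to the character of the stabilizer on its `x`-part. It is injective by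
`IsDualAction.character_ext` and surjective by `IsDualAction.indRep`. -/
theorem IsDualAction.ncard_irredChar_above (h : IsDualAction A H c) (x : X) (d : ℕ) :
    {χ : G → ℂ | (IsIrredChar χ ∧ χ 1 = (d : ℂ)) ∧ isotypicPart A c x χ 1 ≠ 0}.ncard =
      if Nat.card (orbit G x) ∣ d then
        numIrredChar (d / Nat.card (orbit G x)) ↥(stabilizer G x ⊓ H) else 0 := by
  have hcard : Nat.card (orbit G x) ≠ 0 :=
    (@Nat.card_pos (orbit G x) ⟨⟨x, MulAction.mem_orbit_self x⟩⟩ _).ne'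
  have h1 : {χ : G → ℂ | (IsIrredChar χ ∧ χ 1 = (d : ℂ)) ∧ isotypicPart A c x χ 1 ≠ 0}.ncard =
      {ψ : ↥(stabilizer G x ⊓ H) → ℂ |
        IsIrredChar ψ ∧ Nat.card (orbit G x) * ψ 1 = (d : ℂ)}.ncard := by
    refine Set.ncard_congr (fun χ _ => fun s => isotypicPart A c x χ s) ?_ ?_ ?_
    · rintro _ ⟨⟨⟨n, ρ, hρ, rfl⟩, hd⟩, hx⟩
      rw [h.isotypicPart_one_ne_zero] at hx
      refine ⟨?_, ?_⟩
      · convert isIrredChar_character _ (h.isIrreducible_isotypicRep ρ x hρ hx) using 1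
        ext s
        rw [h.character_isotypicRep]
      · rw [h.character_one ρ x hρ hx] at hd
        exact hd
    · rintro χ χ' ⟨⟨hχ, -⟩, hx⟩ ⟨⟨hχ', -⟩, -⟩ he
      exact h.character_ext x hχ hχ' hx fun s hs => congrFun he ⟨s, hs⟩
    · rintro _ ⟨⟨n, σ, hσ, rfl⟩, hd⟩
      have hirr := h.isIrreducible_indRep σ hσ
      have hn : σ.character 1 ≠ 0 := by
        rw [Representation.char_one]
        have := ((isIrreducible_iff σ).mp hσ).1
        exact Nat.cast_ne_zero.mpr Module.finrank_pos.ne'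
      have hx : isotypicPart A c x (h.indRep σ).character 1 ≠ 0 := by
        have := h.isotypicPart_indRep σ 1
        rw [OneMemClass.coe_one] at this
        rwa [this]
      refine ⟨(h.indRep σ).character, ⟨⟨isIrredChar_character _ hirr, ?_⟩, hx⟩, ?_⟩
      · rw [h.character_one _ x hirr ((h.isotypicPart_one_ne_zero _ x).mp hx), ← hd]
        congr 1
        exact h.isotypicPart_indRep σ 1
      · ext s
        exact h.isotypicPart_indRep σ s
  rw [h1]
  split_ifs with hd
  · obtain ⟨e, rfl⟩ := hd
    rw [Nat.mul_div_cancel_left e (Nat.pos_of_ne_zero hcard), numIrredChar]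
    congr 1
    ext ψ
    simp only [Set.mem_ofPred_eq, Nat.cast_mul]
    rw [mul_right_inj' (Nat.cast_ne_zero.mpr hcard)]
  · refine (congrArg Set.ncard ?_).trans (Set.ncard_empty _)
    refine Set.eq_empty_of_forall_notMem ?_
    rintro _ ⟨⟨n, σ, hσ, rfl⟩, he⟩
    rw [Representation.char_one] at he
    exact hd ⟨_, by exact_mod_cast he.symm⟩

/-- The irreducible characters of `G = A H` counted via the orbits of `G` on the characters
of `A`. -/
theorem IsDualAction.numIrredChar_eq (h : IsDualAction A H c) (T : Finset X)
    (hT : ∀ x, ∃ t ∈ T, x ∈ orbit G t) (hT' : ∀ t ∈ T, ∀ t' ∈ T, t' ∈ orbit G t → t = t')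
    (d : ℕ) :
    numIrredChar d G = ∑ t ∈ T, if Nat.card (orbit G t) ∣ d then
      numIrredChar (d / Nat.card (orbit G t)) ↥(stabilizer G t ⊓ H) else 0 := by
  classical
  have hfin : {χ : G → ℂ | IsIrredChar χ ∧ χ 1 = (d : ℂ)}.Finite :=
    (finite_irredChar G).subset fun χ h => h.1
  have hfin' : ∀ t, {χ : G → ℂ | (IsIrredChar χ ∧ χ 1 = (d : ℂ)) ∧
      isotypicPart A c t χ 1 ≠ 0}.Finite := fun t => hfin.subset fun χ h => h.1
  have hU : hfin.toFinset = T.biUnion fun t => (hfin' t).toFinset := by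
    ext χ
    simp only [Set.Finite.mem_toFinset, Finset.mem_biUnion]
    constructor
    · rintro ⟨⟨n, ρ, hρ, rfl⟩, hd⟩
      obtain ⟨x, hx⟩ := h.exists_isotypicSubmodule_ne_bot ρ hρ
      obtain ⟨t, ht, g, hg⟩ := hT x
      refine ⟨t, ht, ⟨⟨n, ρ, hρ, rfl⟩, hd⟩, ?_⟩
      rw [h.isotypicPart_one_ne_zero]
      have h1 := h.isotypicSubmodule_smul_ne_bot ρ g⁻¹ hx
      rw [← hg] at h1
      simpa using h1
    · rintro ⟨t, -, hχ⟩
      exact hχ.1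
  rw [numIrredChar, Set.ncard_eq_toFinset_card _ hfin, hU, Finset.card_biUnion]
  · refine Finset.sum_congr rfl fun t _ => ?_
    rw [← Set.ncard_eq_toFinset_card _ (hfin' t), h.ncard_irredChar_above]
  · intro t ht t' ht' hne
    refine Finset.disjoint_left.mpr fun χ h1 h2 => hne ?_
    rw [Set.Finite.mem_toFinset] at h1 h2
    obtain ⟨⟨⟨n, ρ, hρ, rfl⟩, -⟩, hx⟩ := h1
    have hx' := h2.2
    rw [h.isotypicPart_one_ne_zero] at hx hx'
    exact hT' t ht t' ht' (h.mem_orbit_of_ne_bot ρ hρ hx hx')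

end LittleGroupsCount

/-- A closed set of positions above the diagonal. -/
@[ext]
structure Pattern where
  rel : ℕ → ℕ → Prop
  lt_of_rel : ∀ {i j}, rel i j → i < j
  trans : ∀ {i j k}, rel i j → rel j k → rel i k

/-! ### Pattern groups, and the dual of a row. -/

section PatternGroup

open Matrix

variable (N : ℕ) (F : Type*) [Field F]

theorem mul_apply_of_pattern {N : ℕ} {F : Type*} [Field F] (P : Pattern)
    {a b : Matrix (Fin N) (Fin N) F}
    (ha : ∀ i j : Fin N, ¬ P.rel i j → a i j = (1 : Matrix (Fin N) (Fin N) F) i j)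
    (hb : ∀ i j : Fin N, ¬ P.rel i j → b i j = (1 : Matrix (Fin N) (Fin N) F) i j) (i j : Fin N)
    (hij : ¬ P.rel i j) : (a * b) i j = (1 : Matrix (Fin N) (Fin N) F) i j := by
  rw [← Matrix.one_mul (1 : Matrix (Fin N) (Fin N) F), Matrix.mul_apply, Matrix.mul_apply]
  refine Finset.sum_congr rfl fun k _ => ?_
  by_cases hik : P.rel i k
  · have hkj : ¬ P.rel k j := fun h => hij (P.trans hik h)
    rw [hb k j hkj]
    by_cases hk : k = j
    · subst hk
      exact absurd hik hij
    · rw [Matrix.one_apply_ne hk, mul_zero, mul_zero]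
  · rw [ha i k hik]
    by_cases hk : i = k
    · subst hk
      rw [hb i j hij]
    · rw [Matrix.one_apply_ne hk, zero_mul, zero_mul]

/-- The pattern group of a closed set of positions: the invertible matrices that differ from the
identity matrix at these positions only. -/
def patternGroup [Finite F] (P : Pattern) : Subgroup (GL (Fin N) F) where
  carrier := {g | ∀ i j : Fin N, ¬ P.rel i j → g.1 i j = (1 : Matrix (Fin N) (Fin N) F) i j}
  one_mem' := fun i j _ => rfl
  mul_mem' := fun {a b} ha hb i j hij => mul_apply_of_pattern P ha hb i j hij
  inv_mem' := by
    intro g hg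
    have hpow : ∀ n : ℕ, ∀ i j : Fin N, ¬ P.rel i j →
        (g ^ n).1 i j = (1 : Matrix (Fin N) (Fin N) F) i j := by
      intro n
      induction n with
      | zero => intro i j _; rfl
      | succ n ih =>
        intro i j hij
        rw [pow_succ]
        exact mul_apply_of_pattern P ih hg i j hij
    -- The group is finite because `F` is, so closure under products suffices.
    have : g⁻¹ = g ^ (orderOf g - 1) := by
      rw [inv_eq_iff_mul_eq_one, ← pow_succ',
        Nat.sub_add_cancel (orderOf_pos g), pow_orderOf_eq_one]
    rw [this]
    exact hpow _

variable {N F} [Finite F]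

theorem mem_patternGroup {P : Pattern} {g : GL (Fin N) F} : g ∈ patternGroup N F P ↔
    ∀ i j : Fin N, ¬ P.rel i j → g.1 i j = (1 : Matrix (Fin N) (Fin N) F) i j := Iff.rfl

theorem patternGroup_mono {P Q : Pattern} (h : ∀ i j, P.rel i j → Q.rel i j) :
    patternGroup N F P ≤ patternGroup N F Q := fun _ hg i j hij => hg i j fun h1 => hij (h i j h1)

theorem rel_of_apply_ne_zero {P : Pattern} {g : GL (Fin N) F} (hg : g ∈ patternGroup N F P)
    {i j : Fin N} (hij : i ≠ j) (h : g.1 i j ≠ 0) : P.rel i j := by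
  by_contra h1
  exact h (by rw [hg i j h1, Matrix.one_apply_ne hij])

theorem apply_self_of_mem {P : Pattern} {g : GL (Fin N) F} (hg : g ∈ patternGroup N F P)
    (i : Fin N) : g.1 i i = 1 := by
  rw [hg i i fun h => (P.lt_of_rel h).false, Matrix.one_apply_eq]

/-- The matrix `1 + u vᵀ`, where `v ⬝ᵥ u = 0`. -/
def rankOne (u v : Fin N → F) (h : v ⬝ᵥ u = 0) : GL (Fin N) F where
  val := 1 + vecMulVec u v
  inv := 1 - vecMulVec u v
  val_inv := by
    simp [mul_sub, add_mul, vecMulVec_mul_vecMulVec, h]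
  inv_val := by
    simp [mul_add, sub_mul, vecMulVec_mul_vecMulVec, h]

omit [Finite F] in
theorem rankOne_apply (u v : Fin N → F) (h : v ⬝ᵥ u = 0) (i j : Fin N) :
    (rankOne u v h).1 i j = (1 : Matrix (Fin N) (Fin N) F) i j + u i * v j := rfl

omit [Finite F] in
theorem rankOne_mulVec (u v : Fin N → F) (h : v ⬝ᵥ u = 0) (w : Fin N → F) (i : Fin N) :
    ((rankOne u v h).1 *ᵥ w) i = w i + u i * (v ⬝ᵥ w) := by
  change ((1 + vecMulVec u v) *ᵥ w) i = _
  rw [add_mulVec, one_mulVec, Pi.add_apply, vecMulVec_mulVec]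
  simp

theorem rankOne_mem {P : Pattern} (u v : Fin N → F) (h : v ⬝ᵥ u = 0)
    (hP : ∀ i j : Fin N, u i ≠ 0 → v j ≠ 0 → P.rel i j) :
    rankOne u v h ∈ patternGroup N F P := by
  intro i j hij
  rw [rankOne_apply]
  by_cases hu : u i = 0
  · rw [hu, zero_mul, add_zero]
  · by_cases hv : v j = 0
    · rw [hv, mul_zero, add_zero]
    · exact absurd (hP i j hu hv) hij

theorem mulVec_apply_of_mem {P : Pattern} {g : GL (Fin N) F} (hg : g ∈ patternGroup N F P)
    (v : Fin N → F) (i : Fin N) (hv : ∀ j : Fin N, P.rel i j → v j = 0) :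
    (g.1 *ᵥ v) i = v i := by
  rw [mulVec, dotProduct, Finset.sum_eq_single i, apply_self_of_mem hg, one_mul]
  · intro j _ hj
    by_cases h : P.rel i j
    · rw [hv j h, mul_zero]
    · rw [hg i j h, Matrix.one_apply_ne hj.symm, zero_mul]
  · simp

namespace Pattern

/-- Delete all positions in row `a`. -/
def eraseRow (P : Pattern) (a : ℕ) : Pattern where
  rel i j := P.rel i j ∧ i ≠ a
  lt_of_rel h := P.lt_of_rel h.1
  trans h h' := ⟨P.trans h.1 h'.1, h.2⟩

/-- Keep only the positions in row `a`. -/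
def row (P : Pattern) (a : ℕ) : Pattern where
  rel i j := P.rel i j ∧ i = a
  lt_of_rel h := P.lt_of_rel h.1
  trans h h' := ⟨P.trans h.1 h'.1, h.2⟩

/-- Delete all positions in row `a`, and those positions `(i, k)` in column `k` for which `(a, i)`
is a position of the pattern. -/
def eraseRowCol (P : Pattern) (a k : ℕ) : Pattern where
  rel i j := P.rel i j ∧ i ≠ a ∧ ¬ (j = k ∧ P.rel a i)
  lt_of_rel h := P.lt_of_rel h.1
  trans h h' := ⟨P.trans h.1 h'.1, h.2.1, fun h1 => h'.2.2 ⟨h1.1, P.trans h1.2 h.1⟩⟩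

end Pattern

section RowAction

variable (F) in
/-- The dual of row `a` of a pattern group: the column vectors supported on the positions of that
row. -/
def rowDual (P : Pattern) (a : Fin N) : Submodule F (Fin N → F) where
  carrier := {v | ∀ j : Fin N, ¬ P.rel a j → v j = 0}
  add_mem' := fun {v w} hv hw j hj => by rw [Pi.add_apply, hv j hj, hw j hj, add_zero]
  zero_mem' := fun _ _ => rfl
  smul_mem' := fun c v hv j hj => by rw [Pi.smul_apply, hv j hj, smul_zero]

variable (P : Pattern) (a : Fin N)

-- Truncation is compatible with products because `P` is transitive: if `i` lies above `a` and `g i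
-- j ≠ 0`, then so does `j`, so row `i` never reads a discarded coordinate.
open scoped Classical in
instance rowDualAction : MulAction (patternGroup N F P) (rowDual F P a) where
  smul g v := ⟨fun i => if P.rel a i then (g.1.1 *ᵥ v.1) i else 0, fun j hj => if_neg hj⟩
  one_smul v := by
    ext i
    change (if P.rel a i then ((1 : Matrix (Fin N) (Fin N) F) *ᵥ v.1) i else 0) = v.1 i
    split_ifs with h
    · rw [one_mulVec]
    · exact (v.2 i h).symm
  mul_smul g g' v := by
    ext i
    change (if P.rel a i then ((g.1.1 * g'.1.1) *ᵥ v.1) i else 0) =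
      if P.rel a i then (g.1.1 *ᵥ fun i => if P.rel a i then (g'.1.1 *ᵥ v.1) i else 0) i else 0
    split_ifs with h
    · rw [← mulVec_mulVec, mulVec, mulVec, dotProduct, dotProduct]
      refine Finset.sum_congr rfl fun j _ => ?_
      split_ifs with hj
      · rfl
      · have hij : i ≠ j := by
          rintro rfl
          exact hj h
        have : g.1.1 i j = 0 := by
          by_contra h0
          exact hj (P.trans h (rel_of_apply_ne_zero g.2 hij h0))
        rw [this, zero_mul, zero_mul]
    · rfl

theorem smul_apply_of_rel (g : patternGroup N F P) (v : rowDual F P a) {i : Fin N}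
    (h : P.rel a i) : (g • v : rowDual F P a).1 i = (g.1.1 *ᵥ v.1) i := if_pos h

omit [Finite F] in
theorem rowDual_apply_self (v : rowDual F P a) : v.1 a = 0 :=
  v.2 a fun h => (P.lt_of_rel h).false

/-- The character of row `a` of a pattern group given by a column vector. -/
def rowChar (ψ : AddChar F ℂ) (v : rowDual F P a) (g : patternGroup N F P) : ℂ :=
  ψ ((g.1.1 *ᵥ v.1) a)

/-- The normal subgroup of a pattern group given by row `a`. -/
abbrev rowSubgroup : Subgroup (patternGroup N F P) :=
  (patternGroup N F (P.row a)).subgroupOf (patternGroup N F P)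

/-- The complement of row `a` in a pattern group. -/
abbrev rowComplement : Subgroup (patternGroup N F P) :=
  (patternGroup N F (P.eraseRow a)).subgroupOf (patternGroup N F P)

variable {P a}

theorem mem_rowSubgroup {g : patternGroup N F P} : g ∈ rowSubgroup P a ↔
    ∀ i j : Fin N, i ≠ a → g.1.1 i j = (1 : Matrix (Fin N) (Fin N) F) i j := by
  rw [Subgroup.mem_subgroupOf, mem_patternGroup]
  constructor
  · intro h i j hi
    exact h i j fun h1 => hi (Fin.ext h1.2)
  · intro h i j hij
    by_cases hi : i = a
    · exact g.2 i j fun h1 => hij ⟨h1, congrArg _ hi⟩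
    · exact h i j hi

theorem mem_rowComplement {g : patternGroup N F P} : g ∈ rowComplement P a ↔
    ∀ j : Fin N, g.1.1 a j = (1 : Matrix (Fin N) (Fin N) F) a j := by
  rw [Subgroup.mem_subgroupOf, mem_patternGroup]
  constructor
  · intro h j
    exact h a j fun h1 => h1.2 rfl
  · intro h i j hij
    by_cases hi : i = a
    · rw [hi, h j]
    · exact g.2 i j fun h1 => hij ⟨h1, fun h2 => hi (Fin.ext h2)⟩

theorem mulVec_of_mem_rowSubgroup {g : patternGroup N F P} (hg : g ∈ rowSubgroup P a)
    (w : Fin N → F) {i : Fin N} (hi : i ≠ a) : (g.1.1 *ᵥ w) i = w i := by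
  rw [mem_rowSubgroup] at hg
  conv_rhs => rw [← one_mulVec w]
  rw [mulVec, mulVec]
  congr 1
  ext j
  exact hg i j hi

theorem mulVec_mul_of_mem_rowSubgroup {g : patternGroup N F P} (hg : g ∈ rowSubgroup P a)
    (m : Matrix (Fin N) (Fin N) F) (w : Fin N → F) (hw : w a = 0) :
    ((m * g.1.1) *ᵥ w) = m *ᵥ w + (g.1.1 *ᵥ w) a • fun i => m i a := by
  have h1 : g.1.1 *ᵥ w = w + Pi.single a ((g.1.1 *ᵥ w) a) := by
    ext i
    by_cases hi : i = a
    · subst hi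
      simp [hw]
    · rw [mulVec_of_mem_rowSubgroup hg w hi]
      simp [hi]
  rw [← mulVec_mulVec, h1, mulVec_add, mulVec_single]
  ext i
  simp [hw, mul_comm]

theorem apply_min_column (ha : ∀ i, ¬ P.rel i a) (g : patternGroup N F P) (i : Fin N) :
    g.1.1 i a = (1 : Matrix (Fin N) (Fin N) F) i a :=
  g.2 i a (ha i)

/-- Since column `a` of `g` is that of the identity, left multiplication by `g` does not spread the
modified row `a` into other rows. -/
theorem rowSubgroup_normal (ha : ∀ i, ¬ P.rel i a) : (rowSubgroup (F := F) P a).Normal := by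
  refine ⟨fun b hb g => ?_⟩
  rw [mem_rowSubgroup] at hb ⊢
  intro i j hi
  have h1 : ∀ k, (g.1.1 * b.1.1) i k = g.1.1 i k := by
    intro k
    rw [Matrix.mul_apply]
    conv_rhs => rw [← mul_one g.1.1, Matrix.mul_apply]
    refine Finset.sum_congr rfl fun l _ => ?_
    by_cases hl : l = a
    · rw [hl, apply_min_column ha, Matrix.one_apply_ne hi, zero_mul, zero_mul]
    · rw [hb l k hl]
  have h2 : (g.1.1 * b.1.1 * (g⁻¹).1.1) i j = (g.1.1 * (g⁻¹).1.1) i j := by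
    rw [Matrix.mul_apply, Matrix.mul_apply]
    exact Finset.sum_congr rfl fun k _ => by rw [h1]
  change (g.1.1 * b.1.1 * (g⁻¹).1.1) i j = _
  rw [h2]
  change ((g * g⁻¹ : patternGroup N F P)).1.1 i j = _
  rw [mul_inv_cancel]
  rfl

/-- Row `a` of a pattern group, as a set of vectors. -/
def rowEquiv (P : Pattern) (a : Fin N) : rowDual F P a ≃ rowSubgroup (F := F) P a where
  toFun r := ⟨⟨rankOne (Pi.single a 1) r.1 (by simp [rowDual_apply_self]), rankOne_mem _ _ _ (by
      intro i j hi hj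
      have : i = a := by
        by_contra h
        exact hi (Pi.single_eq_of_ne h _)
      subst this
      by_contra h
      exact hj (r.2 j h))⟩, by
    rw [mem_rowSubgroup]
    intro i j hi
    rw [rankOne_apply, Pi.single_eq_of_ne hi, zero_mul, add_zero]⟩
  invFun g := ⟨fun j => g.1.1.1 a j - (1 : Matrix (Fin N) (Fin N) F) a j, fun j hj => by
    exact sub_eq_zero.mpr (g.1.2 a j hj)⟩
  left_inv r := by
    ext j
    simp [rankOne_apply]
  right_inv g := by
    ext i j
    have := (mem_rowSubgroup.mp g.2) i j
    by_cases hi : i = a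
    · subst hi
      simp [rankOne_apply]
    · rw [this hi]
      simp [rankOne_apply, hi]

theorem rowEquiv_zero : rowEquiv (F := F) P a 0 = 1 := by
  ext i j
  change (1 : Matrix (Fin N) (Fin N) F) i j + _ * 0 = (1 : Matrix (Fin N) (Fin N) F) i j
  rw [mul_zero, add_zero]

theorem rowChar_rowEquiv (ψ : AddChar F ℂ) (v r : rowDual F P a) :
    rowChar P a ψ v (rowEquiv P a r) = ψ (r.1 ⬝ᵥ v.1) := by
  rw [rowChar]
  congr 1
  refine (rankOne_mulVec (Pi.single a 1) r.1 (by simp [rowDual_apply_self]) v.1 a).trans ?_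
  simp [rowDual_apply_self]

-- The map `v ↦ ψ (r ⬝ᵥ v)` is an additive character. If `r k ≠ 0` and `ψ t ≠ 1`, it is nontrivial
-- at the vector with single entry `t / r k`.
open scoped Classical in
theorem sum_rowDual [Fintype (rowDual F P a)] {ψ : AddChar F ℂ} (hψ : ψ ≠ 1) (r : rowDual F P a) :
    ∑ v : rowDual F P a, ψ (r.1 ⬝ᵥ v.1) =
      if r = 0 then (Nat.card (rowSubgroup (F := F) P a) : ℂ) else 0 := by
  let φ : AddChar (rowDual F P a) ℂ :=
    { toFun := fun v => ψ (r.1 ⬝ᵥ v.1)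
      map_zero_eq_one' := by simp
      map_add_eq_mul' := fun v w => by
        simp [AddChar.map_add_eq_mul] }
  have h := AddChar.sum_eq_ite φ
  have h0 : φ = 0 ↔ r = 0 := by
    constructor
    · intro h1
      by_contra hr
      obtain ⟨k, hk⟩ : ∃ k, r.1 k ≠ 0 := by
        by_contra! h2
        exact hr (Subtype.ext (funext h2))
      obtain ⟨t, ht⟩ := (AddChar.ne_one_iff).mp hψ
      have hk' : P.rel a k := by
        by_contra h2
        exact hk (r.2 k h2)
      have hmem : Pi.single k (t / r.1 k) ∈ rowDual F P a := by
        intro j hj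
        refine Pi.single_eq_of_ne ?_ _
        rintro rfl
        exact hj hk'
      have h2 : φ ⟨_, hmem⟩ = 1 := by rw [h1]; rfl
      refine ht ?_
      rw [← h2]
      change ψ t = ψ (r.1 ⬝ᵥ Pi.single k (t / r.1 k))
      rw [dotProduct_single, mul_div_cancel₀ _ hk]
    · rintro rfl
      ext v
      change ψ (0 ⬝ᵥ v.1) = 1
      simp
  refine h.trans ?_
  simp only [h0]
  rw [← Nat.card_congr (rowEquiv (F := F) P a), Nat.card_eq_fintype_card]

open scoped Classical in
theorem isDualAction_row [Fintype (rowDual F P a)] [Fintype (rowSubgroup (F := F) P a)]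
    {ψ : AddChar F ℂ} (hψ : ψ ≠ 1) (ha : ∀ i, ¬ P.rel i a) :
    IsDualAction (rowSubgroup (F := F) P a) (rowComplement P a) (rowChar P a ψ) := by
  have hn := rowSubgroup_normal (F := F) ha
  have hone : ∀ v : rowDual F P a, rowChar P a ψ v 1 = 1 := fun v => by
    rw [rowChar]
    change ψ (((1 : Matrix (Fin N) (Fin N) F) *ᵥ v.1) a) = 1
    rw [one_mulVec, rowDual_apply_self, AddChar.map_zero_eq_one]
  have hmul : ∀ v : rowDual F P a, ∀ b ∈ rowSubgroup P a, ∀ b' ∈ rowSubgroup P a,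
      rowChar P a ψ v (b * b') = rowChar P a ψ v b * rowChar P a ψ v b' := by
    intro v b hb b' hb'
    rw [rowChar, rowChar, rowChar, ← AddChar.map_add_eq_mul]
    congr 1
    change ((b.1.1 * b'.1.1) *ᵥ v.1) a = _
    rw [mulVec_mul_of_mem_rowSubgroup hb' _ _ (rowDual_apply_self P a v), Pi.add_apply,
      Pi.smul_apply, apply_min_column ha, Matrix.one_apply_eq, smul_eq_mul, mul_one]
  refine ⟨hn, hone, hmul, ?_, ?_, ?_, ?_, ?_, ?_⟩
  · intro b hb
    obtain ⟨r, hr⟩ := (rowEquiv P a).surjective ⟨b, hb⟩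
    have hb' : b = (rowEquiv P a r : patternGroup N F P) := by rw [hr]
    have h0 : b = 1 ↔ r = 0 := by
      rw [hb', ← OneMemClass.coe_one (rowSubgroup (F := F) P a), ← rowEquiv_zero,
        Subtype.coe_injective.eq_iff, (rowEquiv P a).injective.eq_iff]
    simp only [h0]
    rw [← sum_rowDual hψ r, hb']
    exact Finset.sum_congr rfl fun v _ => rowChar_rowEquiv ψ v r
  · intro v w
    have hinv : ∀ b : rowSubgroup (F := F) P a,
        rowChar P a ψ w (b : patternGroup N F P)⁻¹ = (rowChar P a ψ w b)⁻¹ := fun b => by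
      refine (inv_eq_of_mul_eq_one_right ?_).symm
      rw [← hmul w b b.2 _ (inv_mem b.2), mul_inv_cancel, hone]
    rw [← (rowEquiv (F := F) P a).sum_comp]
    have h1 : v = w ↔ v - w = 0 := sub_eq_zero.symm
    simp only [h1]
    rw [← sum_rowDual hψ (v - w)]
    refine Finset.sum_congr rfl fun r _ => ?_
    rw [hinv, rowChar_rowEquiv, rowChar_rowEquiv, ← AddChar.map_neg_eq_inv,
      ← AddChar.map_add_eq_mul, Submodule.coe_sub, sub_dotProduct, dotProduct_comm v.1,
      dotProduct_comm w.1, sub_eq_add_neg]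
  · intro g v b hb
    have h1 : ((g * b * g⁻¹).1.1 *ᵥ (g.1.1 *ᵥ v.1)) = (g.1.1 * b.1.1) *ᵥ v.1 := by
      rw [mulVec_mulVec]
      congr 1
      change ((g * b * g⁻¹ * g : patternGroup N F P)).1.1 = (g * b : patternGroup N F P).1.1
      rw [inv_mul_cancel_right]
    -- The part of `g v` lost by truncation vanishes at all indices above `a`, so the conjugated
    -- element leaves its coordinate `a` unchanged.
    have h2 := mulVec_apply_of_mem (g * b * g⁻¹).2 (g.1.1 *ᵥ v.1 - (g • v).1) a fun j hj => by
      rw [Pi.sub_apply, smul_apply_of_rel P a g v hj, sub_self]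
    rw [mulVec_sub, h1, mulVec_mul_of_mem_rowSubgroup hb _ _ (rowDual_apply_self P a v),
      Pi.sub_apply, Pi.sub_apply, Pi.add_apply, rowDual_apply_self, sub_zero, Pi.smul_apply,
      apply_min_column ha, Matrix.one_apply_eq, smul_eq_mul, mul_one] at h2
    rw [rowChar, rowChar]
    congr 1
    linear_combination -h2
  · intro b hb v
    ext i
    by_cases hi : P.rel a i
    · rw [smul_apply_of_rel P a b v hi, mulVec_of_mem_rowSubgroup hb]
      rintro rfl
      exact (P.lt_of_rel hi).false
    · rw [(b • v).2 i hi, v.2 i hi]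
  · intro g
    -- The matrix whose only nontrivial row is row `a` of `g⁻¹` turns row `a` of `g` into that of
    -- the identity; its inverse is the `A`-component of `g`.
    let r : rowDual F P a := ⟨fun j => (g⁻¹).1.1 a j - (1 : Matrix (Fin N) (Fin N) F) a j,
      fun j hj => sub_eq_zero.mpr ((g⁻¹).2 a j hj)⟩
    have hr : ∀ j, (rowEquiv P a r).1.1.1 a j = (g⁻¹).1.1 a j := fun j => by
      change (1 : Matrix (Fin N) (Fin N) F) a j + (Pi.single a 1 : Fin N → F) a * r.1 j = _
      simp [r]
    refine ⟨((rowEquiv P a r)⁻¹ : rowSubgroup P a), SetLike.coe_mem _, (rowEquiv P a r).1 * g, ?_,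
      by simp⟩
    rw [mem_rowComplement]
    intro j
    change ((rowEquiv P a r).1.1.1 * g.1.1) a j = _
    rw [Matrix.mul_apply]
    simp_rw [hr]
    rw [← Matrix.mul_apply]
    change ((g⁻¹ * g : patternGroup N F P)).1.1 a j = _
    rw [inv_mul_cancel]
    rfl
  · intro g hg hg'
    rw [mem_rowSubgroup] at hg
    rw [mem_rowComplement] at hg'
    ext i j
    by_cases hi : i = a
    · subst hi
      exact hg' j
    · exact hg i j hi

end RowAction
end PatternGroup

/-! ### Orbits on the dual of a row, and the recursion for pattern groups. -/

section PatternCount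

open Matrix
open MulAction (stabilizer orbit)

variable {N : ℕ} {F : Type*} [Field F] [Finite F] {P : Pattern} {a : Fin N}

variable (N F) in
/-- The number of irreducible characters of degree `q ^ e` of a pattern group over a field with
`q` elements. -/
def patternCount (e : ℕ) (P : Pattern) : ℕ := numIrredChar (Nat.card F ^ e) (patternGroup N F P)

theorem numIrredChar_stabilizer (d : ℕ) (v : rowDual F P a) (Q : Pattern)
    (hQ : ∀ i j, Q.rel i j → (P.eraseRow a).rel i j)
    (h : ∀ g : patternGroup N F P, g ∈ rowComplement P a →
      (g • v = v ↔ g.1 ∈ patternGroup N F Q)) :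
    numIrredChar d ↥(stabilizer (patternGroup N F P) v ⊓ rowComplement P a) =
      numIrredChar d (patternGroup N F Q) := by
  have hle : patternGroup N F Q ≤ patternGroup N F P :=
    patternGroup_mono fun i j hij => (hQ i j hij).1
  have he : stabilizer (patternGroup N F P) v ⊓ rowComplement P a =
      (patternGroup N F Q).subgroupOf (patternGroup N F P) := by
    ext g
    rw [Subgroup.mem_inf, Subgroup.mem_subgroupOf]
    constructor
    · rintro ⟨h1, h2⟩
      exact (h g h2).mp h1
    · intro h1
      have h2 : g ∈ rowComplement P a := patternGroup_mono hQ h1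
      exact ⟨(h g h2).mpr h1, h2⟩
  exact numIrredChar_congr ((MulEquiv.subgroupCongr he).trans (Subgroup.subgroupOfEquivOfLe hle)) d

/-- The elementary matrix at a position `(i, k)` adds the coordinate `v k` to `v i`, so a fixed
vector must vanish at `k`. -/
theorem forall_smul_eq_iff (v : rowDual F P a) :
    (∀ g : patternGroup N F P, g • v = v) ↔
      ∀ i k : Fin N, P.rel a i → P.rel i k → v.1 k = 0 := by
  constructor
  · intro h i k hi hik
    have hne : i ≠ k := fun h1 => (P.lt_of_rel (h1 ▸ hik : P.rel i i)).false
    have h0 : (Pi.single k (1 : F) : Fin N → F) ⬝ᵥ Pi.single i 1 = 0 := by simp [hne.symm]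
    have hm : rankOne (Pi.single i 1) (Pi.single k (1 : F)) h0 ∈ patternGroup N F P := by
      refine rankOne_mem _ _ _ fun i' k' hi' hk' => ?_
      have h1 : i' = i := by
        by_contra h2
        exact hi' (Pi.single_eq_of_ne h2 _)
      have h2 : k' = k := by
        by_contra h2
        exact hk' (Pi.single_eq_of_ne h2 _)
      rwa [h1, h2]
    have h1 : ((⟨_, hm⟩ : patternGroup N F P) • v).1 i = v.1 i := by rw [h]
    rw [smul_apply_of_rel P a _ v hi, rankOne_mulVec] at h1
    simpa using h1
  · intro h g
    ext i
    by_cases hi : P.rel a i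
    · rw [smul_apply_of_rel P a g v hi]
      exact mulVec_apply_of_mem g.2 _ _ fun j hj => h i j hi hj
    · rw [(g • v).2 i hi, v.2 i hi]

omit [Field F] [Finite F] in
theorem card_supported (S : Finset (Fin N)) (u : Fin N → F) :
    Nat.card {v : Fin N → F // ∀ j ∉ S, v j = u j} = Nat.card F ^ S.card := by
  classical
  let e : {v : Fin N → F // ∀ j ∉ S, v j = u j} ≃ (S → F) :=
    { toFun := fun v j => v.1 j
      invFun := fun f => ⟨fun j => if h : j ∈ S then f ⟨j, h⟩ else u j, fun j hj => dif_neg hj⟩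
      left_inv := fun v => by
        ext j
        by_cases h : j ∈ S
        · simp [h]
        · simp [h, v.2 j h]
      right_inv := fun f => by
        ext j
        simp }
  rw [Nat.card_congr e, Nat.card_fun, Nat.card_eq_fintype_card (α := S), Fintype.card_coe]

theorem exists_addChar (F : Type*) [Field F] [Finite F] : ∃ ψ : AddChar F ℂ, ψ ≠ 1 := by
  obtain ⟨ψ, hψ⟩ := AddChar.exists_apply_ne_zero.mpr (one_ne_zero : (1 : F) ≠ 0)
  exact ⟨ψ, fun h => hψ (by rw [h]; rfl)⟩

theorem card_orbit_of_fixed {G X : Type*} [Group G] [MulAction G X] {x : X}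
    (h : ∀ g : G, g • x = x) : Nat.card (orbit G x) = 1 := by
  have : orbit G x = {x} := by
    ext y
    constructor
    · rintro ⟨g, rfl⟩
      exact h g
    · rintro rfl
      exact MulAction.mem_orbit_self _
  rw [this, Nat.card_unique]

theorem fixed_of_card_orbit {G X : Type*} [Group G] [MulAction G X] {x : X}
    (h : Nat.card (orbit G x) = 1) (g : G) : g • x = x := by
  have := (Nat.card_eq_one_iff_unique.mp h).1
  exact congrArg Subtype.val
    (Subsingleton.elim (⟨g • x, g, rfl⟩ : orbit G x) ⟨x, MulAction.mem_orbit_self x⟩)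

theorem numIrredChar_stabilizer_of_fixed (d : ℕ) {v : rowDual F P a}
    (hv : ∀ g : patternGroup N F P, g • v = v) :
    numIrredChar d ↥(stabilizer (patternGroup N F P) v ⊓ rowComplement P a) =
      numIrredChar d (patternGroup N F (P.eraseRow a)) :=
  numIrredChar_stabilizer d v _ (fun _ _ h => h) fun g hg =>
    ⟨fun _ => hg, fun _ => hv g⟩

theorem card_fixed (M : Finset (Fin N)) (hM : ∀ k, k ∈ M ↔ P.rel a k ∧ ∀ i : Fin N, P.rel a i →
      ¬ P.rel i k) :
    Nat.card {v : rowDual F P a // ∀ g : patternGroup N F P, g • v = v} = Nat.card F ^ M.card := by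
  rw [← card_supported M 0]
  refine Nat.card_congr
    { toFun := fun v => ⟨v.1.1, fun j hj => ?_⟩
      invFun := fun v => ⟨⟨v.1, fun j hj => v.2 j fun h => hj ((hM j).mp h).1⟩, ?_⟩
      left_inv := fun v => rfl
      right_inv := fun v => rfl }
  · rw [hM] at hj
    push Not at hj
    by_cases h : P.rel a j
    · obtain ⟨i, hi, hij⟩ := hj h
      exact (forall_smul_eq_iff v.1).mp v.2 i j hi hij
    · exact v.1.2 j h
  · rw [forall_smul_eq_iff]
    exact fun i k hi hik => v.2 k fun h => ((hM k).mp h).2 i hi hik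

/-- Linear characters of a pattern group, by removing the row of a minimal element. -/
theorem patternCount_zero (ha : ∀ i, ¬ P.rel i a) (M : Finset (Fin N))
    (hM : ∀ k, k ∈ M ↔ P.rel a k ∧ ∀ i : Fin N, P.rel a i → ¬ P.rel i k) :
    patternCount N F 0 P = Nat.card F ^ M.card * patternCount N F 0 (P.eraseRow a) := by
  classical
  have := Fintype.ofFinite (rowDual F P a)
  have := Fintype.ofFinite (rowSubgroup (F := F) P a)
  obtain ⟨ψ, hψ⟩ := exists_addChar F
  have hD := isDualAction_row hψ ha
  let T : Finset (rowDual F P a) :=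
    (Set.range fun ω : MulAction.orbitRel.Quotient (patternGroup N F P) (rowDual F P a) =>
      ω.out).toFinset
  have hT : ∀ x, ∃ t ∈ T, x ∈ orbit (patternGroup N F P) t := by
    intro x
    refine ⟨_, Set.mem_toFinset.mpr ⟨Quotient.mk'' x, rfl⟩, ?_⟩
    rw [← MulAction.orbitRel_apply]
    exact Quotient.exact' (Quotient.out_eq' _).symm
  have hT' : ∀ t ∈ T, ∀ t' ∈ T, t' ∈ orbit (patternGroup N F P) t → t = t' := by
    intro t ht t' ht' h
    obtain ⟨ω, rfl⟩ := Set.mem_toFinset.mp ht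
    obtain ⟨ω', rfl⟩ := Set.mem_toFinset.mp ht'
    have : ω' = ω := by
      rw [← Quotient.out_eq' ω, ← Quotient.out_eq' ω']
      exact Quotient.sound' h
    rw [this]
  -- An orbit size dividing `1` equals `1`: only fixed characters of the row lie under linear
  -- characters.
  have hterm : ∀ t : rowDual F P a, (if Nat.card (orbit (patternGroup N F P) t) ∣ Nat.card F ^ 0 then
      numIrredChar (Nat.card F ^ 0 / Nat.card (orbit (patternGroup N F P) t))
        ↥(stabilizer (patternGroup N F P) t ⊓ rowComplement P a) else 0) =
      if ∀ g : patternGroup N F P, g • t = t then patternCount N F 0 (P.eraseRow a) else 0 := by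
    intro t
    by_cases h : ∀ g : patternGroup N F P, g • t = t
    · rw [if_pos h, card_orbit_of_fixed h, if_pos (one_dvd _), Nat.div_one,
        numIrredChar_stabilizer_of_fixed _ h, patternCount]
    · rw [if_neg h, if_neg]
      intro h1
      rw [pow_zero, Nat.dvd_one] at h1
      exact h (fixed_of_card_orbit h1)
  rw [patternCount, hD.numIrredChar_eq T hT hT', Finset.sum_congr rfl fun t _ => hterm t,
    ← Finset.sum_filter, Finset.sum_const, smul_eq_mul, ← card_fixed (F := F) M hM,
    Nat.card_eq_fintype_card, Fintype.card_subtype]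
  congr 2
  ext x
  simp only [Finset.mem_filter, Finset.mem_univ, true_and, and_iff_right_iff_imp]
  intro hx
  obtain ⟨t, ht, g, hg⟩ := hT x
  have : t = x := by
    have h1 : t = g⁻¹ • x := by rw [← hg]; simp
    rw [h1, hx]
  rwa [← this]

variable (P a) in
open scoped Classical in
/-- The multiple `c` of the unit vector at a position `k` of row `a`. -/
def rowSingle (k : Fin N) (c : F) : rowDual F P a :=
  ⟨fun j => if P.rel a k then (Pi.single k c : Fin N → F) j else 0, fun j hj => by
    split_ifs with h
    · refine Pi.single_eq_of_ne ?_ _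
      rintro rfl
      exact hj h
    · rfl⟩

omit [Finite F] in
theorem coe_rowSingle {k : Fin N} (h : P.rel a k) (c : F) :
    (rowSingle P a k c).1 = Pi.single k c := by
  ext j
  exact if_pos h

theorem smul_rowSingle {k : Fin N} (h : P.rel a k) (c : F) (g : patternGroup N F P) {i : Fin N}
    (hi : P.rel a i) : (g • rowSingle P a k c).1 i = g.1.1 i k * c := by
  rw [smul_apply_of_rel P a g _ hi, coe_rowSingle h, mulVec_single]
  simp [mul_comm]

/-- The image of `c e_k` is `c` times column `k` of a unitriangular matrix, truncated. By `hlow` all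
entries of that column in rows above `a` and less than `k` are free. -/
theorem mem_orbit_rowSingle {k : Fin N} (hk : P.rel a k)
    (hlow : ∀ i : Fin N, P.rel a i → i < k → P.rel i k) {c : F} (hc : c ≠ 0) (v : rowDual F P a) :
    v ∈ orbit (patternGroup N F P) (rowSingle P a k c) ↔
      v.1 k = c ∧ ∀ i, k < i → v.1 i = 0 := by
  constructor
  · rintro ⟨g, rfl⟩
    refine ⟨?_, fun i hi => ?_⟩
    · rw [smul_rowSingle hk c g hk, apply_self_of_mem g.2, one_mul]
    · by_cases h : P.rel a i
      · have : g.1.1 i k = 0 := by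
          by_contra h0
          have := P.lt_of_rel (rel_of_apply_ne_zero g.2 hi.ne' h0)
          exact absurd hi (not_lt.mpr this.le)
        change (g • rowSingle P a k c).1 i = 0
        rw [smul_rowSingle hk c g h, this, zero_mul]
      · exact (g • rowSingle P a k c).2 i h
  · rintro ⟨hvk, hv⟩
    -- Column `k` of `1 + w e_kᵀ` must be `v / c`, the diagonal entry coming from the identity.
    let w : Fin N → F := fun i => if i < k then v.1 i / c else 0
    have h0 : (Pi.single k (1 : F) : Fin N → F) ⬝ᵥ w = 0 := by simp [w]
    have hm : rankOne w (Pi.single k (1 : F)) h0 ∈ patternGroup N F P := by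
      refine rankOne_mem _ _ _ fun i j hi hj => ?_
      have hj' : j = k := by
        by_contra h2
        exact hj (Pi.single_eq_of_ne h2 _)
      have hik : i < k := by
        by_contra h2
        exact hi (if_neg h2)
      rw [hj']
      refine hlow i ?_ hik
      by_contra h2
      refine hi ?_
      simp [w, v.2 i h2]
    refine ⟨⟨_, hm⟩, ?_⟩
    ext i
    by_cases hi : P.rel a i
    · change ((⟨_, hm⟩ : patternGroup N F P) • rowSingle P a k c).1 i = v.1 i
      rw [smul_rowSingle hk c _ hi, rankOne_apply]
      rcases lt_trichotomy i k with h | h | h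
      · simp [w, h, h.ne, hc]
      · subst h
        simp [w, hvk]
      · simp [w, h.not_gt, h.ne', hv i h]
    · rw [v.2 i hi]
      exact ((⟨_, hm⟩ : patternGroup N F P) • rowSingle P a k c).2 i hi

theorem card_orbit_rowSingle {k : Fin N} (hk : P.rel a k)
    (hlow : ∀ i : Fin N, P.rel a i → i < k → P.rel i k) {c : F} (hc : c ≠ 0)
    (L : Finset (Fin N)) (hL : ∀ i, i ∈ L ↔ P.rel a i ∧ i < k) :
    Nat.card (orbit (patternGroup N F P) (rowSingle P a k c)) = Nat.card F ^ L.card := by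
  rw [← card_supported L (Pi.single k c)]
  refine Nat.card_congr
    { toFun := fun v => ⟨v.1.1, fun j hj => ?_⟩
      invFun := fun v => ⟨⟨v.1, fun j hj => ?_⟩, ?_⟩
      left_inv := fun v => rfl
      right_inv := fun v => rfl }
  · obtain ⟨h1, h2⟩ := (mem_orbit_rowSingle hk hlow hc v.1).mp v.2
    rw [hL] at hj
    rcases lt_trichotomy j k with h | h | h
    · rw [Pi.single_eq_of_ne h.ne]
      exact v.1.2 j fun h3 => hj ⟨h3, h⟩
    · rw [h, Pi.single_eq_same, h1]
    · rw [Pi.single_eq_of_ne h.ne', h2 j h]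
  · rw [v.2 j fun h => hj ((hL j).mp h).1, Pi.single_eq_of_ne]
    rintro rfl
    exact hj hk
  · rw [mem_orbit_rowSingle hk hlow hc]
    refine ⟨?_, fun i hi => ?_⟩
    · rw [v.2 k fun h => ((hL k).mp h).2.false, Pi.single_eq_same]
    · rw [v.2 i fun h => ((hL i).mp h).2.not_gt hi, Pi.single_eq_of_ne hi.ne']

theorem numIrredChar_stabilizer_rowSingle (d : ℕ) {k : Fin N} (hk : P.rel a k) {c : F}
    (hc : c ≠ 0) :
    numIrredChar d ↥(stabilizer (patternGroup N F P) (rowSingle P a k c) ⊓ rowComplement P a) =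
      numIrredChar d (patternGroup N F (P.eraseRowCol a k)) := by
  refine numIrredChar_stabilizer d _ _ (fun _ _ h => ⟨h.1, h.2.1⟩) fun g hg => ?_
  constructor
  · intro h i j hij
    by_cases h1 : (P.eraseRow a).rel i j
    · have h2 : j = k ∧ P.rel a i := by
        by_contra h2
        exact hij ⟨h1.1, h1.2, fun h3 => h2 ⟨Fin.ext h3.1, h3.2⟩⟩
      have h3 := smul_rowSingle hk c g h2.2
      rw [h, coe_rowSingle hk, h2.1.symm] at h3
      have hne : i ≠ j := fun h4 => (P.lt_of_rel (h4 ▸ h1.1 : P.rel i i)).false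
      rw [Pi.single_eq_of_ne hne] at h3
      rw [Matrix.one_apply_ne hne]
      exact (mul_eq_zero.mp h3.symm).resolve_right hc
    · exact hg i j h1
  · intro h
    ext i
    by_cases hi : P.rel a i
    · rw [smul_rowSingle hk c g hi, coe_rowSingle hk, h i k fun h1 => h1.2.2 ⟨rfl, hi⟩]
      by_cases hik : i = k
      · subst hik
        simp
      · simp [hik]
    · rw [(g • rowSingle P a k c).2 i hi, (rowSingle P a k c).2 i hi]

/-- Irreducible characters of a pattern group, by removing the row of a minimal element `a`, where
the elements above `a` that are not in the set `C` are minimal among them, and those in `C` are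
comparable to all of them. -/
theorem patternCount_eq (e : ℕ) (ha : ∀ i, ¬ P.rel i a) (M C : Finset (Fin N))
    (hM : ∀ k, k ∈ M ↔ P.rel a k ∧ k ∉ C) (hC : ∀ k ∈ C, P.rel a k)
    (hmin : ∀ k ∈ M, ∀ i : Fin N, P.rel a i → ¬ P.rel i k)
    (hlow : ∀ k ∈ C, ∀ i : Fin N, P.rel a i → i < k → P.rel i k)
    (hhigh : ∀ k ∈ C, ∀ i ∈ M, k < i → P.rel k i)
    (L : Fin N → Finset (Fin N)) (hL : ∀ k ∈ C, ∀ i, i ∈ L k ↔ P.rel a i ∧ i < k) :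
    patternCount N F e P = Nat.card F ^ M.card * patternCount N F e (P.eraseRow a) +
      ∑ k ∈ C, (Nat.card F - 1) * if (L k).card ≤ e then
        patternCount N F (e - (L k).card) (P.eraseRowCol a k) else 0 := by
  classical
  have := Fintype.ofFinite (rowDual F P a)
  have := Fintype.ofFinite (rowSubgroup (F := F) P a)
  have := Fintype.ofFinite F
  obtain ⟨ψ, hψ⟩ := exists_addChar F
  have hD := isDualAction_row hψ ha
  have hq : 1 < Nat.card F := Finite.one_lt_card
  have hfix : ∀ v : rowDual F P a, (∀ k ∈ C, v.1 k = 0) →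
      ∀ g : patternGroup N F P, g • v = v := by
    intro v hv
    rw [forall_smul_eq_iff]
    intro i k hi hik
    by_cases hk : k ∈ C
    · exact hv k hk
    · by_contra h0
      have hak : P.rel a k := by
        by_contra h1
        exact h0 (v.2 k h1)
      exact hmin k ((hM k).mpr ⟨hak, hk⟩) i hi hik
  -- `T₁` consists of fixed vectors, since its coordinates lie at minimal indices. Any other vector
  -- is equivalent to its entry at the largest `k ∈ C` where it is nonzero.
  let T₁ : Finset (rowDual F P a) := Finset.univ.filter fun v => ∀ k ∈ C, v.1 k = 0
  let T₂ : Finset (rowDual F P a) :=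
    (C ×ˢ Finset.univ.filter fun c : F => c ≠ 0).image fun p => rowSingle P a p.1 p.2
  have hT₁ : ∀ v, v ∈ T₁ ↔ ∀ k ∈ C, v.1 k = 0 := fun v => by simp [T₁]
  have hT₂ : ∀ v, v ∈ T₂ ↔ ∃ k ∈ C, ∃ c : F, c ≠ 0 ∧ rowSingle P a k c = v := fun v => by
    simp [T₂, and_assoc]
  have hdisj : Disjoint T₁ T₂ := by
    refine Finset.disjoint_left.mpr fun v h1 h2 => ?_
    obtain ⟨k, hk, c, hc, rfl⟩ := (hT₂ v).mp h2
    have := (hT₁ _).mp h1 k hk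
    rw [coe_rowSingle (hC k hk), Pi.single_eq_same] at this
    exact hc this
  have hT : ∀ x, ∃ t ∈ T₁ ∪ T₂, x ∈ orbit (patternGroup N F P) t := by
    intro v
    by_cases hv : ∀ k ∈ C, v.1 k = 0
    · exact ⟨v, Finset.mem_union_left _ ((hT₁ v).mpr hv), MulAction.mem_orbit_self v⟩
    · obtain ⟨k, hk, hmax⟩ := Finset.exists_max_image (C.filter fun k => v.1 k ≠ 0) id (by
        push Not at hv
        obtain ⟨k, hk, hv⟩ := hv
        exact ⟨k, Finset.mem_filter.mpr ⟨hk, hv⟩⟩)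
      rw [Finset.mem_filter] at hk
      refine ⟨rowSingle P a k (v.1 k), Finset.mem_union_right _
        ((hT₂ _).mpr ⟨k, hk.1, _, hk.2, rfl⟩), ?_⟩
      rw [mem_orbit_rowSingle (hC k hk.1) (hlow k hk.1) hk.2]
      refine ⟨rfl, fun i hi => ?_⟩
      by_contra h0
      by_cases hiC : i ∈ C
      · exact absurd hi (not_lt.mpr (hmax i (Finset.mem_filter.mpr ⟨hiC, h0⟩)))
      · have hai : P.rel a i := by
          by_contra h1
          exact h0 (v.2 i h1)
        have hiM := (hM i).mpr ⟨hai, hiC⟩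
        -- A nonzero entry beyond `k` at an index of `M` is impossible: by `hhigh` that index would
        -- lie above `k`, against its minimality.
        exact hmin i hiM k (hC k hk.1) (hhigh k hk.1 i hiM hi)
  have hT' : ∀ t ∈ T₁ ∪ T₂, ∀ t' ∈ T₁ ∪ T₂, t' ∈ orbit (patternGroup N F P) t → t = t' := by
    intro t ht t' ht' h
    rcases Finset.mem_union.mp ht with ht | ht
    · obtain ⟨g, rfl⟩ := h
      exact (hfix t ((hT₁ t).mp ht) g).symm
    rcases Finset.mem_union.mp ht' with ht' | ht'
    · obtain ⟨g, hg⟩ := MulAction.mem_orbit_symm.mp h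
      exact hg.symm.trans (hfix t' ((hT₁ t').mp ht') g)
    obtain ⟨k, hk, c, hc, rfl⟩ := (hT₂ t).mp ht
    obtain ⟨k', hk', c', hc', rfl⟩ := (hT₂ t').mp ht'
    rw [mem_orbit_rowSingle (hC k hk) (hlow k hk) hc, coe_rowSingle (hC k' hk')] at h
    have hkk : k = k' := by
      by_contra h1
      rw [Pi.single_eq_of_ne h1] at h
      exact hc h.1.symm
    subst hkk
    rw [Pi.single_eq_same] at h
    rw [h.1]
  have hcard : T₁.card = Nat.card F ^ M.card := by
    rw [← card_supported (F := F) M 0, ← Fintype.card_coe, ← Nat.card_eq_fintype_card]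
    refine Nat.card_congr
      { toFun := fun v => ⟨v.1.1, fun j hj => ?_⟩
        invFun := fun v => ⟨⟨v.1, fun j hj => v.2 j fun h => hj ((hM j).mp h).1⟩, ?_⟩
        left_inv := fun v => rfl
        right_inv := fun v => rfl }
    · by_cases hjC : j ∈ C
      · exact (hT₁ v.1).mp v.2 j hjC
      · exact v.1.2 j fun h => hj ((hM j).mpr ⟨h, hjC⟩)
    · rw [hT₁]
      exact fun k hk => v.2 k fun h => ((hM k).mp h).2 hk
  rw [patternCount, hD.numIrredChar_eq _ hT hT', Finset.sum_union hdisj]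
  congr 1
  · rw [← hcard, ← smul_eq_mul, ← Finset.sum_const]
    refine Finset.sum_congr rfl fun t ht => ?_
    have hf := hfix t ((hT₁ t).mp ht)
    rw [card_orbit_of_fixed hf, if_pos (one_dvd _), Nat.div_one,
      numIrredChar_stabilizer_of_fixed _ hf, patternCount]
  · rw [Finset.sum_image, Finset.sum_product]
    · refine Finset.sum_congr rfl fun k hk => ?_
      have hcF : (Finset.univ.filter fun c : F => c ≠ 0).card = Nat.card F - 1 := by
        rw [Finset.filter_ne', Finset.card_erase_of_mem (Finset.mem_univ _), Finset.card_univ,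
          Nat.card_eq_fintype_card]
      rw [← hcF, ← smul_eq_mul, ← Finset.sum_const]
      refine Finset.sum_congr rfl fun c hc => ?_
      have hc0 : c ≠ 0 := (Finset.mem_filter.mp hc).2
      rw [card_orbit_rowSingle (hC k hk) (hlow k hk) hc0 (L k) (hL k hk)]
      simp only [Nat.pow_dvd_pow_iff_le_right hq]
      split_ifs with hle
      · rw [numIrredChar_stabilizer_rowSingle _ (hC k hk) hc0, patternCount,
          Nat.pow_div hle (zero_lt_one.trans hq)]
      · rfl
    · rintro ⟨k, c⟩ hp ⟨k', c'⟩ hp' h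
      obtain ⟨hk, hc⟩ := Finset.mem_product.mp hp
      obtain ⟨hk', -⟩ := Finset.mem_product.mp hp'
      have hc0 : c ≠ 0 := (Finset.mem_filter.mp hc).2
      have h1 := congrArg Subtype.val h
      simp only [coe_rowSingle (hC _ hk), coe_rowSingle (hC _ hk')] at h1
      have h2 := congrFun h1 k
      rw [Pi.single_eq_same] at h2
      by_cases hkk : k = k'
      · subst hkk
        rw [Pi.single_eq_same] at h2
        rw [h2]
      · rw [Pi.single_eq_of_ne hkk] at h2
        exact absurd h2 hc0

end PatternCount

/-! ### Patterns close to the full triangle. -/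

section ChainPatterns

variable {N : ℕ} {F : Type*} [Field F] [Finite F] {P : Pattern} {a : ℕ}

theorem patternCount_of_trivial (h : ∀ i j, j < N → ¬ P.rel i j) (e : ℕ) :
    patternCount N F e P = if e = 0 then 1 else 0 := by
  have : Subsingleton (patternGroup N F P) := by
    refine ⟨fun g g' => ?_⟩
    ext i j
    rw [g.2 i j (h i j j.2), g'.2 i j (h i j j.2)]
  have hq : 1 < Nat.card F := Finite.one_lt_card
  rw [patternCount, numIrredChar_of_subsingleton]
  simp only [Nat.pow_eq_one, hq.ne', false_or]

/-- Linear characters of a pattern group, by removing the row of a minimal element. -/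
theorem patternCount_zero_eq (haN : a < N) (ha : ∀ i, ¬ P.rel i a) (M : Finset ℕ)
    (hM : ∀ k, k ∈ M ↔ k < N ∧ P.rel a k ∧ ∀ i, P.rel a i → ¬ P.rel i k) :
    patternCount N F 0 P = Nat.card F ^ M.card * patternCount N F 0 (P.eraseRow a) := by
  have hMN : ∀ k ∈ M, k < N := fun k hk => ((hM k).mp hk).1
  rw [patternCount_zero (a := ⟨a, haN⟩) ha (M.attachFin hMN), Finset.card_attachFin]
  intro k
  rw [Finset.mem_attachFin, hM]
  refine ⟨fun h => ⟨h.2.1, fun i => h.2.2 i⟩, fun h => ⟨k.2, h.1, fun i hi hik => ?_⟩⟩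
  exact h.2 ⟨i, (P.lt_of_rel hik).trans k.2⟩ hi hik

/-- Irreducible characters of a pattern group, by removing the row of a minimal element `a`, if
the elements above `a` and less than `s` are minimal among those above `a`, and the others form
a chain above them. -/
theorem patternCount_eq_of_chain (e : ℕ) (haN : a < N) (ha : ∀ i, ¬ P.rel i a) (s : ℕ)
    (hs : s ≤ N) (M : Finset ℕ) (hM : ∀ k, k ∈ M ↔ P.rel a k ∧ k < s)
    (hC : ∀ k, s ≤ k → P.rel a k) (hmin : ∀ k i, k < s → P.rel a i → ¬ P.rel i k)
    (hlow : ∀ k i, s ≤ k → P.rel a i → i < k → P.rel i k) :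
    patternCount N F e P = Nat.card F ^ M.card * patternCount N F e (P.eraseRow a) +
      ∑ j ∈ Finset.range (e + 1 - M.card), if s + j < N then (Nat.card F - 1) *
        patternCount N F (e - M.card - j) (P.eraseRowCol a (s + j)) else 0 := by
  classical
  have hMN : ∀ k ∈ M, k < N := fun k hk => ((hM k).mp hk).2.trans_le hs
  have hCN : ∀ k ∈ Finset.Ico s N, k < N := fun k hk => (Finset.mem_Ico.mp hk).2
  have hLN : ∀ k : Fin N, ∀ i ∈ M ∪ Finset.Ico s k, i < N := fun k i hi => by
    rcases Finset.mem_union.mp hi with hi | hi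
    · exact hMN i hi
    · exact (Finset.mem_Ico.mp hi).2.trans k.2
  -- For `k = s + j` the orbit has size `q ^ (|M| + j)`, so only `j ≤ e - |M|` can contribute to
  -- degree `q ^ e`.
  have hLcard : ∀ k, (M ∪ Finset.Ico s k).card = M.card + (k - s) := fun k => by
    rw [Finset.card_union_of_disjoint, Nat.card_Ico]
    refine Finset.disjoint_left.mpr fun i hi hi' => ?_
    exact absurd ((hM i).mp hi).2 (not_lt.mpr (Finset.mem_Ico.mp hi').1)
  rw [patternCount_eq (a := ⟨a, haN⟩) e ha (M.attachFin hMN) ((Finset.Ico s N).attachFin hCN)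
    (L := fun k => (M ∪ Finset.Ico s k).attachFin (hLN k)), Finset.card_attachFin]
  · congr 1
    simp only [Finset.card_attachFin, hLcard]
    let f : ℕ → ℕ := fun k => (Nat.card F - 1) * if M.card + (k - s) ≤ e then
      patternCount N F (e - (M.card + (k - s))) (P.eraseRowCol a k) else 0
    have h1 : ∑ k ∈ (Finset.Ico s N).attachFin hCN, f k = ∑ k ∈ Finset.Ico s N, f k := by
      refine Finset.sum_bij (fun k _ => k.1) ?_ ?_ ?_ ?_
      · intro k hk
        exact Finset.mem_attachFin _ |>.mp hk
      · intro k _ k' _ h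
        exact Fin.ext h
      · intro k hk
        exact ⟨⟨k, hCN k hk⟩, (Finset.mem_attachFin _).mpr hk, rfl⟩
      · intro k _
        rfl
    refine h1.trans ?_
    rw [Finset.sum_Ico_eq_sum_range, ← Finset.sum_filter]
    have hf : ∀ j, f (s + j) = if j < e + 1 - M.card then (Nat.card F - 1) *
        patternCount N F (e - M.card - j) (P.eraseRowCol a (s + j)) else 0 := by
      intro j
      simp only [f, Nat.add_sub_cancel_left]
      by_cases hj : M.card + j ≤ e
      · rw [if_pos hj, if_pos (by omega), Nat.sub_sub]
      · rw [if_neg hj, if_neg (by omega), mul_zero]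
    rw [Finset.sum_congr rfl fun j _ => hf j, ← Finset.sum_filter]
    refine Finset.sum_congr ?_ fun _ _ => rfl
    ext j
    simp only [Finset.mem_filter, Finset.mem_range]
    omega
  · intro k
    rw [Finset.mem_attachFin, Finset.mem_attachFin, hM, Finset.mem_Ico]
    constructor
    · exact fun h => ⟨h.1, fun h' => absurd h.2 (not_lt.mpr h'.1)⟩
    · refine fun h => ⟨h.1, ?_⟩
      by_contra h1
      exact h.2 ⟨not_lt.mp h1, k.2⟩
  · intro k hk
    rw [Finset.mem_attachFin, Finset.mem_Ico] at hk
    exact hC k hk.1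
  · intro k hk i hi
    rw [Finset.mem_attachFin, hM] at hk
    exact hmin k i hk.2 hi
  · intro k hk i hi hik
    rw [Finset.mem_attachFin, Finset.mem_Ico] at hk
    exact hlow k i hk.1 hi hik
  · intro k hk i hi hki
    rw [Finset.mem_attachFin, Finset.mem_Ico] at hk
    rw [Finset.mem_attachFin, hM] at hi
    exact absurd (hk.1.trans_lt hki) hi.2.not_gt
  · intro k hk i
    rw [Finset.mem_attachFin, Finset.mem_Ico] at hk
    rw [Finset.mem_attachFin, Finset.mem_union, hM, Finset.mem_Ico]
    constructor
    · rintro (h | h)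
      · exact ⟨h.1, Fin.lt_def.mpr (h.2.trans_le hk.1)⟩
      · exact ⟨hC i h.1, Fin.lt_def.mpr h.2⟩
    · rintro ⟨h1, h2⟩
      rcases lt_or_ge i.1 s with h | h
      · exact Or.inl ⟨h1, h⟩
      · exact Or.inr ⟨h, Fin.lt_def.mp h2⟩

namespace Pattern

/-- All positions `(i, j)` with `a ≤ i < j`. -/
def chain (a : ℕ) : Pattern where
  rel i j := a ≤ i ∧ i < j
  lt_of_rel := by omega
  trans := by omega

/-- All positions `(i, j)` with `a ≤ i < j`, except for those in column `a + k`. -/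
def chainEraseCol (a k : ℕ) : Pattern where
  rel i j := a ≤ i ∧ i < j ∧ j ≠ a + k
  lt_of_rel := by omega
  trans := by omega

/-- All positions `(i, j)` with `a ≤ i < j`, except for those in column `a + k` which are not in
row `a`. -/
def chainKeepTop (a k : ℕ) : Pattern where
  rel i j := a ≤ i ∧ i < j ∧ (j ≠ a + k ∨ i = a)
  lt_of_rel := by omega
  trans := by omega

/-- All positions `(i, j)` with `a ≤ i < j`, except for the first two in row `a`. -/
def chainEraseTwo (a : ℕ) : Pattern where
  rel i j := a ≤ i ∧ i < j ∧ (i ≠ a ∨ a + 2 < j)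
  lt_of_rel := by omega
  trans := by omega

theorem eraseRow_chain (a : ℕ) : (chain a).eraseRow a = chain (a + 1) := by
  ext i j
  simp only [eraseRow, chain]
  omega

theorem eraseRowCol_chain (a k : ℕ) :
    (chain a).eraseRowCol a (a + 2 + k) = chainEraseCol (a + 1) (k + 1) := by
  ext i j
  simp only [eraseRowCol, chain, chainEraseCol]
  omega

theorem eraseRow_chainEraseCol_one (a : ℕ) :
    (chainEraseCol a 1).eraseRow a = chain (a + 1) := by
  ext i j
  simp only [eraseRow, chain, chainEraseCol]
  omega

theorem eraseRow_chainEraseCol (a k : ℕ) :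
    (chainEraseCol a (k + 1)).eraseRow a = chainEraseCol (a + 1) k := by
  ext i j
  simp only [eraseRow, chainEraseCol]
  omega

/-- With column `a + 1` erased, `a + 1` is not above `a`. The position of row `a + 1` in the cleared
column therefore survives. -/
theorem eraseRowCol_chainEraseCol_one (a k : ℕ) :
    (chainEraseCol a 1).eraseRowCol a (a + 3 + k) = chainKeepTop (a + 1) (k + 2) := by
  ext i j
  simp only [eraseRowCol, chainKeepTop, chainEraseCol]
  omega

/-- Clearing column `a + 3` removes only `(a + 1, a + 3)`, because `a + 2` is not above `a`; in row
`a + 1` the position `(a + 1, a + 2)` was already missing. -/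
theorem eraseRowCol_chainEraseCol_two (a : ℕ) :
    (chainEraseCol a 2).eraseRowCol a (a + 3) = chainEraseTwo (a + 1) := by
  ext i j
  simp only [eraseRowCol, chainEraseTwo, chainEraseCol]
  omega

theorem eraseRow_chainKeepTop (a k : ℕ) :
    (chainKeepTop a (k + 1)).eraseRow a = chainEraseCol (a + 1) k := by
  ext i j
  simp only [eraseRow, chainKeepTop, chainEraseCol]
  omega

theorem eraseRow_chainEraseTwo (a : ℕ) :
    (chainEraseTwo a).eraseRow a = chain (a + 1) := by
  ext i j
  simp only [eraseRow, chainEraseTwo, chain]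
  omega

end Pattern

end ChainPatterns

/-! ### Recursions in `q` for the counts of degrees `1`, `q`, `q ^ 2` and `q ^ 3`. -/

section ChainCounts

variable {R : Type*} [CommRing R]

/-- The number of linear characters for `chainEraseCol a 1` with `m` elements, as a function of the
order `q` of the field. -/
def linearEraseCol (q : R) (m : ℕ) : R := if m ≤ 1 then 0 else if m = 2 then 1 else q ^ (m - 1)

/-- The number of linear characters for `chainEraseTwo a` with `m` elements. -/
def linearEraseTwo (q : R) (m : ℕ) : R := if m ≤ 2 then 0 else if m = 3 then q else q ^ (m - 1)

/-- The number of characters of degree `q` for `chain a` with `m` elements. -/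
def chainOne (q : R) : ℕ → R
  | 0 => 0
  | 1 => 0
  -- For `m = 0` there is no second orbit type, which the value `0` of `linearEraseCol` below two
  -- indices takes into account; the other recursions treat their boundary in the same way.
  | m + 2 => q * chainOne q (m + 1) + (q - 1) * linearEraseCol q (m + 1)

/-- The number of characters of degree `q` for `chainEraseCol a 1` with `m` elements. -/
def eraseColOne (q : R) : ℕ → R
  | 0 => 0
  | 1 => 0
  | 2 => 0
  | m + 3 => q * chainOne q (m + 2) + (q - 1) * (q ^ 2 * linearEraseCol q (m + 1))

/-- The number of characters of degree `q` for `chainEraseCol a 2` with `m` elements. -/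
def eraseColTwoOne (q : R) : ℕ → R
  | 0 => 0
  | 1 => 0
  | 2 => 0
  | m + 3 => q * eraseColOne q (m + 2) + (q - 1) * linearEraseTwo q (m + 2)

/-- The number of characters of degree `q ^ 2` for `chain a` with `m` elements. -/
def chainTwo (q : R) : ℕ → R
  | 0 => 0
  | 1 => 0
  | m + 2 => q * chainTwo q (m + 1) + (q - 1) * eraseColOne q (m + 1) +
      (q - 1) * (q * linearEraseCol q m)

/-- The number of characters of degree `q ^ 2` for `chainEraseCol a 1` with `m` elements. -/
def eraseColTwo (q : R) : ℕ → R
  | 0 => 0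
  | 1 => 0
  | 2 => 0
  | m + 3 => q * chainTwo q (m + 2) + (q - 1) * (q ^ 2 * eraseColOne q (m + 1)) +
      (q - 1) * (q ^ 2 * (q * linearEraseCol q m))

/-- The number of characters of degree `q ^ 3` for `chain a` with `m` elements. -/
def chainThree (q : R) : ℕ → R
  | 0 => 0
  | 1 => 0
  -- The terms after the first belong to orbits of sizes `q`, `q ^ 2`, `q ^ 3`, leaving stabilizer
  -- degrees `q ^ 2`, `q`, `1`. Truncation in `m - 1` is harmless, as the last factor is `0` for `m
  -- ≤ 2`.
  | m + 2 => q * chainThree q (m + 1) + (q - 1) * eraseColTwo q (m + 1) +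
      (q - 1) * eraseColTwoOne q (m + 1) + (q - 1) * (q * (q * linearEraseCol q (m - 1)))

open Pattern

variable (R)
variable {N : ℕ} {F : Type*} [Field F] [Finite F] {a m : ℕ}

theorem cast_card_sub_one (F : Type*) [Field F] [Finite F] :
    ((Nat.card F - 1 : ℕ) : R) = (Nat.card F : R) - 1 :=
  Nat.cast_pred Nat.card_pos

theorem patternCount_zero_chain (h : a + (m + 1) = N) :
    (patternCount N F 0 (chain a) : R) = Nat.card F ^ m := by
  induction m generalizing a with
  | zero =>
    rw [patternCount_of_trivial]
    · simp
    · simp only [chain]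
      omega
  | succ m ih =>
    rw [patternCount_zero_eq (a := a) (by omega) (by simp only [chain]; omega) {a + 1},
      eraseRow_chain, Nat.cast_mul, ih (by omega)]
    · rw [Finset.card_singleton]
      push_cast
      ring
    · intro k
      simp only [Finset.mem_singleton, chain]
      refine ⟨fun hk => ⟨by omega, by omega, by omega⟩, fun hk => ?_⟩
      have := hk.2.2 (a + 1)
      omega

/-- Here `a + 1` is the only minimal index above `a`, so `c e_k` at `k = a + 2 + j` has an orbit of
size `q ^ (1 + j)`. -/
theorem patternCount_chain (e : ℕ) (h : a + (m + 2) = N) :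
    patternCount N F e (chain a) = Nat.card F * patternCount N F e (chain (a + 1)) +
      ∑ j ∈ Finset.range e, if j < m then (Nat.card F - 1) *
        patternCount N F (e - 1 - j) (chainEraseCol (a + 1) (j + 1)) else 0 := by
  rw [patternCount_eq_of_chain (a := a) e (by omega) (by simp only [chain]; omega) (a + 2)
    (by omega) {a + 1}, Finset.card_singleton, pow_one, eraseRow_chain]
  · simp only [eraseRowCol_chain, Nat.add_sub_cancel]
    congr 1
    refine Finset.sum_congr rfl fun j _ => ?_
    have : a + 2 + j < N ↔ j < m := by omega
    simp only [this]
  all_goals simp only [Finset.mem_singleton, chain]; omega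

theorem patternCount_chain_of_le (e : ℕ) (hm : m ≤ 1) (h : a + m = N) :
    patternCount N F (e + 1) (chain a) = 0 := by
  rw [patternCount_of_trivial, if_neg (Nat.succ_ne_zero e)]
  simp only [chain]
  omega

theorem patternCount_zero_chainEraseCol_one (h : a + (m + 2) = N) :
    (patternCount N F 0 (chainEraseCol a 1) : R) = linearEraseCol (Nat.card F : R) (m + 2) := by
  rcases m with - | m
  -- Column `a + 2` lies outside the matrix, so the group is trivial: the value is `1` instead of
  -- `q`.
  · rw [patternCount_of_trivial]
    · simp [linearEraseCol]
    · simp only [chainEraseCol]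
      omega
  · rw [patternCount_zero_eq (a := a) (by omega) (by simp only [chainEraseCol]; omega) {a + 2},
      eraseRow_chainEraseCol_one, Nat.cast_mul, patternCount_zero_chain R (m := m + 1) (by omega)]
    · rw [Finset.card_singleton, linearEraseCol, if_neg (by omega), if_neg (by omega),
        show m + 1 + 2 - 1 = m + 2 by omega]
      push_cast
      ring
    · intro k
      simp only [Finset.mem_singleton, chainEraseCol]
      refine ⟨fun hk => ⟨by omega, by omega, by omega⟩, fun hk => ?_⟩
      have := hk.2.2 (a + 2)
      omega

theorem patternCount_zero_chainEraseCol (k : ℕ) (h : a + (m + k + 3) = N) :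
    patternCount N F 0 (chainEraseCol a (k + 2)) =
      Nat.card F * patternCount N F 0 (chainEraseCol (a + 1) (k + 1)) := by
  rw [patternCount_zero_eq (a := a) (by omega) (by simp only [chainEraseCol]; omega) {a + 1},
    eraseRow_chainEraseCol, Finset.card_singleton, pow_one]
  intro l
  simp only [Finset.mem_singleton, chainEraseCol]
  refine ⟨fun hk => ⟨by omega, by omega, by omega⟩, fun hk => ?_⟩
  have := hk.2.2 (a + 1)
  omega

theorem patternCount_zero_chainEraseCol_two (h : a + (m + 3) = N) :
    (patternCount N F 0 (chainEraseCol a 2) : R) =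
      Nat.card F * linearEraseCol (Nat.card F : R) (m + 2) := by
  rw [patternCount_zero_chainEraseCol (m := m) 0 (by omega), Nat.cast_mul,
    patternCount_zero_chainEraseCol_one R (m := m) (by omega)]

theorem patternCount_zero_chainEraseCol_three (h : a + (m + 4) = N) :
    (patternCount N F 0 (chainEraseCol a 3) : R) =
      Nat.card F * (Nat.card F * linearEraseCol (Nat.card F : R) (m + 2)) := by
  rw [patternCount_zero_chainEraseCol (m := m) 1 (by omega), Nat.cast_mul,
    patternCount_zero_chainEraseCol_two R (m := m) (by omega)]

theorem patternCount_zero_chainKeepTop (k : ℕ) (h : a + (m + k + 3) = N) :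
    patternCount N F 0 (chainKeepTop a (k + 2)) =
      Nat.card F ^ 2 * patternCount N F 0 (chainEraseCol (a + 1) (k + 1)) := by
  rw [patternCount_zero_eq (a := a) (by omega) (by simp only [chainKeepTop]; omega)
    {a + 1, a + (k + 2)}, eraseRow_chainKeepTop, Finset.card_pair (by omega)]
  intro l
  simp only [Finset.mem_insert, Finset.mem_singleton, chainKeepTop, or_true, and_true]
  refine ⟨fun hk => ⟨by omega, by omega, by omega⟩, fun hk => ?_⟩
  have := hk.2.2 (a + 1)
  omega

theorem patternCount_zero_chainEraseTwo (h : a + (m + 3) = N) :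
    (patternCount N F 0 (chainEraseTwo a) : R) = linearEraseTwo (Nat.card F : R) (m + 3) := by
  rcases m with - | m
  -- With three indices row `a` is empty, hence the exceptional value `q`.
  · rw [patternCount_zero_eq (a := a) (by omega) (by simp only [chainEraseTwo]; omega) ∅,
      eraseRow_chainEraseTwo, Nat.cast_mul, patternCount_zero_chain R (m := 1) (by omega)]
    · simp [linearEraseTwo]
    · intro k
      simp only [chainEraseTwo, Finset.notMem_empty]
      refine ⟨False.elim, fun hk => by omega⟩
  · rw [patternCount_zero_eq (a := a) (by omega) (by simp only [chainEraseTwo]; omega) {a + 3},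
      eraseRow_chainEraseTwo, Nat.cast_mul, patternCount_zero_chain R (m := m + 2) (by omega)]
    · rw [Finset.card_singleton, linearEraseTwo, if_neg (by omega), if_neg (by omega),
        show m + 1 + 3 - 1 = m + 3 by omega]
      push_cast
      ring
    · intro k
      simp only [Finset.mem_singleton, chainEraseTwo]
      refine ⟨fun hk => ⟨by omega, by omega, by omega⟩, fun hk => ?_⟩
      have := hk.2.2 (a + 3)
      omega

theorem patternCount_one_chain (h : a + m = N) :
    (patternCount N F 1 (chain a) : R) = chainOne (Nat.card F : R) m := by
  induction m generalizing a with
  | zero => rw [patternCount_chain_of_le 0 (Nat.zero_le 1) h, Nat.cast_zero, chainOne]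
  | succ m ih =>
    rcases m with - | m
    · rw [patternCount_chain_of_le 0 le_rfl h, Nat.cast_zero, chainOne]
    · rw [patternCount_chain 1 h, Nat.cast_add, Nat.cast_mul, ih (by omega), chainOne]
      congr 1
      rw [Finset.sum_range_one]
      rcases m with - | m
      · simp [linearEraseCol]
      · rw [if_pos (by omega), Nat.cast_mul, cast_card_sub_one,
          patternCount_zero_chainEraseCol_one R (m := m) (by omega)]

theorem patternCount_chainEraseCol_one (e : ℕ) (h : a + (m + 3) = N) :
    patternCount N F e (chainEraseCol a 1) = Nat.card F * patternCount N F e (chain (a + 1)) +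
      ∑ j ∈ Finset.range e, if j < m then (Nat.card F - 1) *
        patternCount N F (e - 1 - j) (chainKeepTop (a + 1) (j + 2)) else 0 := by
  rw [patternCount_eq_of_chain (a := a) e (by omega) (by simp only [chainEraseCol]; omega) (a + 3)
    (by omega) {a + 2}, Finset.card_singleton, pow_one, eraseRow_chainEraseCol_one]
  · simp only [eraseRowCol_chainEraseCol_one, Nat.add_sub_cancel]
    congr 1
    refine Finset.sum_congr rfl fun j _ => ?_
    have : a + 3 + j < N ↔ j < m := by omega
    simp only [this]
  all_goals simp only [Finset.mem_singleton, chainEraseCol]; omega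

theorem patternCount_chainEraseCol_one_of_two (e : ℕ) (h : a + 2 = N) :
    patternCount N F (e + 1) (chainEraseCol a 1) = 0 := by
  rw [patternCount_of_trivial, if_neg (Nat.succ_ne_zero e)]
  simp only [chainEraseCol]
  omega

theorem patternCount_one_chainEraseCol_one (h : a + (m + 2) = N) :
    (patternCount N F 1 (chainEraseCol a 1) : R) = eraseColOne (Nat.card F : R) (m + 2) := by
  rcases m with - | m
  · rw [patternCount_chainEraseCol_one_of_two 0 h, Nat.cast_zero, eraseColOne]
  · rw [patternCount_chainEraseCol_one 1 h, Nat.cast_add, Nat.cast_mul,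
      patternCount_one_chain R (m := m + 2) (by omega), eraseColOne, Finset.sum_range_one]
    congr 1
    rcases m with - | m
    · simp [linearEraseCol]
    · rw [if_pos (by omega), Nat.cast_mul, cast_card_sub_one,
        patternCount_zero_chainKeepTop (m := m) 0 (by omega), Nat.cast_mul,
        patternCount_zero_chainEraseCol_one R (m := m) (by omega), Nat.cast_pow]

theorem patternCount_one_chainEraseCol_two (h : a + (m + 3) = N) :
    (patternCount N F 1 (chainEraseCol a 2) : R) = eraseColTwoOne (Nat.card F : R) (m + 3) := by
  rw [patternCount_eq_of_chain (a := a) 1 (by omega) (by simp only [chainEraseCol]; omega) (a + 3)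
    (by omega) {a + 1}, Finset.card_singleton, pow_one, eraseRow_chainEraseCol, Nat.cast_add,
    Nat.cast_mul, patternCount_one_chainEraseCol_one R (m := m) (by omega), eraseColTwoOne]
  · congr 1
    rw [Nat.add_sub_cancel, Finset.sum_range_one]
    rcases m with - | m
    · rw [if_neg (by omega)]
      simp [linearEraseTwo]
    · rw [if_pos (by omega), add_zero, eraseRowCol_chainEraseCol_two, Nat.cast_mul,
        cast_card_sub_one, patternCount_zero_chainEraseTwo R (m := m) (by omega)]
  all_goals simp only [Finset.mem_singleton, chainEraseCol]; omega

/-- Both `a + 1` and `a + 2` are minimal above `a`, so orbits not reduced to a point have size at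
least `q ^ 2` and contribute nothing in degree `q`. -/
theorem patternCount_one_chainKeepTop (h : a + (m + 3) = N) :
    (patternCount N F 1 (chainKeepTop a 2) : R) =
      Nat.card F ^ 2 * eraseColOne (Nat.card F : R) (m + 2) := by
  rw [patternCount_eq_of_chain (a := a) 1 (by omega) (by simp only [chainKeepTop]; omega) (a + 3)
    (by omega) {a + 1, a + 2}, Finset.card_pair (by omega), eraseRow_chainKeepTop]
  · rw [Finset.range_zero, Finset.sum_empty, add_zero, Nat.cast_mul,
      patternCount_one_chainEraseCol_one R (m := m) (by omega), Nat.cast_pow]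
  all_goals simp only [Finset.mem_insert, Finset.mem_singleton, chainKeepTop, or_true, and_true]; omega

theorem patternCount_two_chain (h : a + m = N) :
    (patternCount N F 2 (chain a) : R) = chainTwo (Nat.card F : R) m := by
  induction m generalizing a with
  | zero => rw [patternCount_chain_of_le 1 (Nat.zero_le 1) h, Nat.cast_zero, chainTwo]
  | succ m ih =>
    rcases m with - | m
    · rw [patternCount_chain_of_le 1 le_rfl h, Nat.cast_zero, chainTwo]
    · rw [patternCount_chain 2 h, Nat.cast_add, Nat.cast_mul, ih (by omega), chainTwo,
        Finset.sum_range_succ, Finset.sum_range_one, add_assoc, Nat.cast_add]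
      congr 2
      · rcases m with - | m
        · simp [eraseColOne]
        · rw [if_pos (by omega), Nat.cast_mul, cast_card_sub_one,
            patternCount_one_chainEraseCol_one R (m := m) (by omega)]
      · rcases m with - | - | m
        · simp [linearEraseCol]
        · simp [linearEraseCol]
        · rw [if_pos (by omega), Nat.cast_mul, cast_card_sub_one,
            patternCount_zero_chainEraseCol_two R (m := m) (by omega)]

theorem patternCount_two_chainEraseCol_one (h : a + (m + 2) = N) :
    (patternCount N F 2 (chainEraseCol a 1) : R) = eraseColTwo (Nat.card F : R) (m + 2) := by
  rcases m with - | m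
  · rw [patternCount_chainEraseCol_one_of_two 1 h, Nat.cast_zero, eraseColTwo]
  · rw [patternCount_chainEraseCol_one 2 h, Nat.cast_add, Nat.cast_mul,
      patternCount_two_chain R (m := m + 2) (by omega), eraseColTwo,
      Finset.sum_range_succ, Finset.sum_range_one, add_assoc, Nat.cast_add]
    congr 2
    · rcases m with - | m
      · simp [eraseColOne]
      · rw [if_pos (by omega), Nat.cast_mul, cast_card_sub_one,
          patternCount_one_chainKeepTop R (m := m) (by omega)]
    · rcases m with - | - | m
      · simp [linearEraseCol]
      · simp [linearEraseCol]
      · rw [if_pos (by omega), Nat.cast_mul, cast_card_sub_one,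
          patternCount_zero_chainKeepTop (m := m) 1 (by omega), Nat.cast_mul,
          patternCount_zero_chainEraseCol_two R (m := m) (by omega), Nat.cast_pow]

theorem patternCount_three_chain (h : a + m = N) :
    (patternCount N F 3 (chain a) : R) = chainThree (Nat.card F : R) m := by
  induction m generalizing a with
  | zero => rw [patternCount_chain_of_le 2 (Nat.zero_le 1) h, Nat.cast_zero, chainThree]
  | succ m ih =>
    rcases m with - | m
    · rw [patternCount_chain_of_le 2 le_rfl h, Nat.cast_zero, chainThree]
    · rw [patternCount_chain 3 h, Nat.cast_add, Nat.cast_mul, ih (by omega), chainThree,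
        Finset.sum_range_succ, Finset.sum_range_succ, Finset.sum_range_one, add_assoc, add_assoc,
        Nat.cast_add, Nat.cast_add, add_assoc]
      congr 2
      · rcases m with - | m
        · simp [eraseColTwo]
        · rw [if_pos (by omega), Nat.cast_mul, cast_card_sub_one,
            patternCount_two_chainEraseCol_one R (m := m) (by omega)]
      congr 1
      · rcases m with - | - | m
        · simp [eraseColTwoOne]
        · simp [eraseColTwoOne]
        · rw [if_pos (by omega), Nat.cast_mul, cast_card_sub_one,
            patternCount_one_chainEraseCol_two R (m := m) (by omega)]
      · rcases m with - | - | - | m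
        · simp [linearEraseCol]
        · simp [linearEraseCol]
        · simp [linearEraseCol]
        · rw [if_pos (by omega), Nat.cast_mul, cast_card_sub_one,
            patternCount_zero_chainEraseCol_three R (m := m) (by omega)]
          rfl

/-- The number of irreducible characters of degree `q ^ 3` of the unitriangular group. -/
theorem numIrredChar_unitriangular (n : ℕ) :
    (numIrredChar (Nat.card F ^ 3) (unitriangular n F) : R) =
      chainThree (Nat.card F : R) n := by
  rw [← patternCount_three_chain R (F := F) (Nat.zero_add n), patternCount]
  refine congrArg _ (numIrredChar_congr (MulEquiv.subgroupCongr ?_) _)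
  ext g
  rw [mem_patternGroup]
  constructor
  · rintro ⟨h1, h2⟩ i j hij
    have hle : j ≤ i := by
      by_contra h3
      exact hij ⟨Nat.zero_le _, Fin.lt_def.mp (not_le.mp h3)⟩
    rcases hle.lt_or_eq with h | h
    · rw [h1 i j h, Matrix.one_apply_ne h.ne']
    · rw [h, h2, Matrix.one_apply_eq]
  · intro h
    have h1 : ∀ i j : Fin n, j ≤ i → g.1 i j = (1 : Matrix (Fin n) (Fin n) F) i j :=
      fun i j hij => h i j fun h3 => absurd (Fin.lt_def.mpr h3.2) (not_lt.mpr hij)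
    exact ⟨fun i j hij => by rw [h1 i j hij.le, Matrix.one_apply_ne hij.ne'],
      fun i => by rw [h1 i i le_rfl, Matrix.one_apply_eq]⟩

end ChainCounts

/-! ### Solving the recursions over `ℚ`. -/

section ClosedFormulas

theorem linearEraseCol_add_three {R : Type*} [CommRing R] (q : R) (t : ℕ) :
    linearEraseCol q (t + 3) = q ^ (t + 2) := by
  rw [linearEraseCol, if_neg (by omega), if_neg (by omega)]
  rfl

theorem linearEraseTwo_add_four {R : Type*} [CommRing R] (q : R) (t : ℕ) :
    linearEraseTwo q (t + 4) = q ^ (t + 3) := by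
  rw [linearEraseTwo, if_neg (by omega), if_neg (by omega)]
  rfl

variable (q : ℚ) (t : ℕ)

theorem chainOne_closed : chainOne q (t + 3) = q ^ t * (q - 1) * (1 + t * q) := by
  induction t with
  | zero => simp [chainOne, linearEraseCol]
  | succ t ih =>
    rw [show t + 1 + 3 = (t + 2) + 2 by ring, chainOne, show t + 2 + 1 = t + 3 by ring, ih,
      linearEraseCol_add_three]
    push_cast
    ring

theorem eraseColOne_closed :
    eraseColOne q (t + 5) = q ^ (t + 2) * (q - 1) * (1 + (t + 1) * q + q ^ 2) := by
  rw [show t + 5 = (t + 2) + 3 by ring, eraseColOne, show t + 2 + 2 = (t + 1) + 3 by ring,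
    chainOne_closed, show t + 2 + 1 = t + 3 by ring, linearEraseCol_add_three]
  push_cast
  ring

theorem eraseColTwoOne_closed :
    eraseColTwoOne q (t + 6) = q ^ (t + 3) * (q - 1) * (1 + (t + 2) * q + q ^ 2) := by
  rw [show t + 6 = (t + 3) + 3 by ring, eraseColTwoOne, show t + 3 + 2 = t + 5 by ring,
    eraseColOne_closed, show t + 5 = (t + 1) + 4 by ring, linearEraseTwo_add_four]
  ring

theorem chainTwo_closed :
    chainTwo q (t + 5) = q ^ t * (q - 1) * (q * (2 * q ^ 2 + q - 1) +
      t * ((q - 1) * q * (1 + q ^ 2) + q ^ 3) + (q - 1) * q ^ 2 * (t * (t + 1) / 2)) := by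
  induction t with
  | zero =>
    simp [chainTwo, eraseColOne, chainOne, linearEraseCol]
    ring
  | succ t ih =>
    rw [show t + 1 + 5 = (t + 4) + 2 by ring, chainTwo, show t + 4 + 1 = t + 5 by ring, ih,
      eraseColOne_closed, show t + 4 = (t + 1) + 3 by ring, linearEraseCol_add_three]
    push_cast
    ring

theorem eraseColTwo_closed :
    eraseColTwo q (t + 7) = q * chainTwo q (t + 6) +
      (q - 1) * (q ^ 2 * (q ^ (t + 2) * (q - 1) * (1 + (t + 1) * q + q ^ 2))) +
      (q - 1) * q ^ (t + 6) := by
  rw [show t + 7 = (t + 4) + 3 by ring, eraseColTwo, show t + 4 + 1 = t + 5 by ring,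
    eraseColOne_closed, show t + 4 = (t + 1) + 3 by ring, linearEraseCol_add_three]
  ring

theorem chainThree_five : chainThree q 5 = q * (q - 1) * (2 * q - 1) := by
  simp [chainThree, eraseColTwo, eraseColTwoOne, chainTwo, eraseColOne, chainOne, linearEraseCol,
    linearEraseTwo]
  ring

theorem chainThree_six : chainThree q 6 = q ^ 2 * (q - 1) * (4 * q ^ 2 + q - 3) := by
  simp [chainThree, eraseColTwo, eraseColTwoOne, chainTwo, eraseColOne, chainOne, linearEraseCol,
    linearEraseTwo]
  ring

theorem chainThree_seven : chainThree q 7 =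
    q ^ 2 * (q - 1) * (3 * q ^ 4 + 6 * q ^ 3 - 2 * q ^ 2 - 5 * q + 1) := by
  simp [chainThree, eraseColTwo, eraseColTwoOne, chainTwo, eraseColOne, chainOne, linearEraseCol,
    linearEraseTwo]
  ring

/-- The inhomogeneous terms are replaced by their closed forms; that of `eraseColTwo` at `n - 1`
starts at index `7`, which is the reason for `8 ≤ n`. -/
theorem chainThree_rec (n : ℕ) (hn : 8 ≤ n) : chainThree q n = q * chainThree q (n - 1) +
    q ^ (n - 5) * (q - 1) * (q ^ 5 + (2 * n - 14) * q ^ 4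
      + (25 - 3 * n + ((n : ℚ) - 6) * (n - 5) / 2) * q ^ 3
      + (n - 11 - ((n : ℚ) - 7) * (n - 6)) * q ^ 2
      + (5 - n + ((n : ℚ) - 8) * (n - 7) / 2) * q + n - 6) := by
  obtain ⟨t, rfl⟩ := Nat.exists_eq_add_of_le' hn
  rw [show t + 8 - 1 = t + 7 by omega, show t + 8 - 5 = t + 3 by omega,
    show t + 8 = (t + 6) + 2 by ring, chainThree, show t + 6 + 1 = t + 7 by ring,
    eraseColTwo_closed, show t + 7 = (t + 1) + 6 by ring, eraseColTwoOne_closed,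
    show t + 6 - 1 = (t + 2) + 3 by omega, linearEraseCol_add_three,
    show t + 6 = (t + 1) + 5 by ring, chainTwo_closed]
  push_cast
  ring

/-- After division by `q ^ (n - 5) * (q - 1)` the recursion just adds its bracket, so the
coefficients are partial sums, in `n`, of those of the bracket. As these are at most quadratic in
`n`, the sums are at most cubic. -/
theorem chainThree_closed (n : ℕ) (hn : 7 ≤ n) : chainThree q n = q ^ (n - 5) * (q - 1) *
    (coeffA.eval (n : ℚ) * q ^ 5 + coeffB.eval (n : ℚ) * q ^ 4 + coeffC.eval (n : ℚ) * q ^ 3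
      + coeffD.eval (n : ℚ) * q ^ 2 + coeffE.eval (n : ℚ) * q + coeffF.eval (n : ℚ)) := by
  induction n, hn using Nat.le_induction with
  | base =>
    rw [chainThree_seven]
    simp only [coeffA, coeffB, coeffC, coeffD, coeffE, coeffF, eval_add, eval_sub, eval_mul,
      eval_X, eval_C, eval_ofNat, eval_neg, eval_one]
    push_cast
    ring
  | succ n hn ih =>
    rw [chainThree_rec q (n + 1) (by omega), Nat.add_sub_cancel, ih]
    obtain ⟨t, rfl⟩ := Nat.exists_eq_add_of_le' hn
    rw [show t + 7 - 5 = t + 2 by omega, show t + 7 + 1 - 5 = t + 3 by omega]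
    simp only [coeffA, coeffB, coeffC, coeffD, coeffE, coeffF, eval_add, eval_sub, eval_mul,
      eval_X, eval_C, eval_ofNat, eval_neg, eval_one]
    push_cast
    ring

theorem map_chainThree {R S : Type*} [CommRing R] [CommRing S] (f : R →+* S) (q : R) (n : ℕ) :
    f (chainThree q n) = chainThree (f q) n := by
  have h0 : ∀ m, f (linearEraseCol q m) = linearEraseCol (f q) m := fun m => by
    simp [linearEraseCol, apply_ite f]
  have h1 : ∀ m, f (linearEraseTwo q m) = linearEraseTwo (f q) m := fun m => by
    simp [linearEraseTwo, apply_ite f]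
  have h2 : ∀ m, f (chainOne q m) = chainOne (f q) m := fun m => by
    fun_induction chainOne q m <;> simp_all [chainOne]
  have h3 : ∀ m, f (eraseColOne q m) = eraseColOne (f q) m := fun m => by
    fun_cases eraseColOne q m <;> simp_all [eraseColOne]
  have h4 : ∀ m, f (eraseColTwoOne q m) = eraseColTwoOne (f q) m := fun m => by
    fun_cases eraseColTwoOne q m <;> simp_all [eraseColTwoOne]
  have h5 : ∀ m, f (chainTwo q m) = chainTwo (f q) m := fun m => by
    fun_induction chainTwo q m <;> simp_all [chainTwo]
  have h6 : ∀ m, f (eraseColTwo q m) = eraseColTwo (f q) m := fun m => by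
    fun_cases eraseColTwo q m <;> simp_all [eraseColTwo]
  fun_induction chainThree q n <;> simp_all [chainThree]

end ClosedFormulas

/-! ### Integrality of the coefficients. -/

section IntegerValued

theorem exists_eq_two_mul (m : ℤ) : ∃ k : ℤ, (m : ℚ) * (m + 1) = 2 * k := by
  obtain ⟨k, hk⟩ := Int.even_mul_succ_self m
  refine ⟨k, ?_⟩
  have : m * (m + 1) = 2 * k := by rw [hk]; ring
  exact_mod_cast this

theorem exists_eq_six_mul (m : ℤ) : ∃ k : ℤ, (m : ℚ) * (m + 1) * (2 * m + 1) = 6 * k := by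
  have h : (6 : ℤ) ∣ m * (m + 1) * (2 * m + 1) := by
    refine Int.dvd_of_emod_eq_zero ?_
    have h6 : m % 6 = 0 ∨ m % 6 = 1 ∨ m % 6 = 2 ∨ m % 6 = 3 ∨ m % 6 = 4 ∨ m % 6 = 5 := by omega
    rcases h6 with h | h | h | h | h | h <;> simp [Int.mul_emod, Int.add_emod, h]
  obtain ⟨k, hk⟩ := h
  exact ⟨k, by exact_mod_cast hk⟩

/-- Since `17 / 4 = 51 / 12`, the fractional terms of `coeffC` are integral only jointly. The
divisibility is checked on residues modulo `12`. -/
theorem exists_eq_twelve_mul (m : ℤ) : ∃ k : ℤ,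
    (m : ℚ) * (m + 1) * (2 * m + 1) - 51 * (m + 8) * (m - 7) = 12 * k := by
  have h : (12 : ℤ) ∣ m * (m + 1) * (2 * m + 1) - 51 * (m + 8) * (m - 7) := by
    refine Int.dvd_of_emod_eq_zero ?_
    have h12 : m % 12 = 0 ∨ m % 12 = 1 ∨ m % 12 = 2 ∨ m % 12 = 3 ∨ m % 12 = 4 ∨ m % 12 = 5 ∨
      m % 12 = 6 ∨ m % 12 = 7 ∨ m % 12 = 8 ∨ m % 12 = 9 ∨ m % 12 = 10 ∨ m % 12 = 11 := by omega
    rcases h12 with h | h | h | h | h | h | h | h | h | h | h | h <;>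
      simp [Int.mul_emod, Int.add_emod, Int.sub_emod, h]
  obtain ⟨k, hk⟩ := h
  exact ⟨k, by exact_mod_cast hk⟩

theorem isIntegerValued_coeffA : IsIntegerValued coeffA := fun m =>
  ⟨m - 7, by simp [coeffA]⟩

theorem isIntegerValued_coeffB : IsIntegerValued coeffB := fun m =>
  ⟨3 + (m - 7) * (m - 6), by simp [coeffB]⟩

theorem isIntegerValued_coeffC : IsIntegerValued coeffC := fun m => by
  obtain ⟨k, hk⟩ := exists_eq_twelve_mul m
  refine ⟨40 * (m - 7) + k - 64, ?_⟩
  simp only [coeffC, eval_add, eval_sub, eval_mul, eval_X, eval_C, eval_ofNat, eval_one]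
  push_cast
  linear_combination (1 / 12) * hk

theorem isIntegerValued_coeffD : IsIntegerValued coeffD := fun m => by
  obtain ⟨k, hk⟩ := exists_eq_six_mul m
  refine ⟨(m - 7) * (7 * m + 3) - k + 138, ?_⟩
  simp only [coeffD, eval_add, eval_sub, eval_mul, eval_X, eval_C, eval_ofNat, eval_one]
  push_cast
  linear_combination (-1 / 6) * hk

theorem isIntegerValued_coeffE : IsIntegerValued coeffE := fun m => by
  obtain ⟨k, hk⟩ := exists_eq_twelve_mul m
  -- Replacing `m` by `m + 8` in `-(17 / 4) m (m - 7)` costs `34 (m - 7)`; together with `-(m - 7)`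
  -- this leaves `33 (m - 7)`.
  refine ⟨33 * (m - 7) + k - 75, ?_⟩
  simp only [coeffE, eval_add, eval_sub, eval_mul, eval_X, eval_C, eval_ofNat, eval_one, eval_neg]
  push_cast
  linear_combination (1 / 12) * hk

theorem isIntegerValued_coeffF : IsIntegerValued coeffF := fun m => by
  obtain ⟨k, hk⟩ := exists_eq_two_mul m
  -- `(m - 7)(m - 4) / 2 = m (m + 1) / 2 - 6 m + 14`.
  refine ⟨1 + k - 6 * m + 14, ?_⟩
  simp only [coeffF, eval_add, eval_sub, eval_mul, eval_X, eval_C, eval_ofNat, eval_one]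
  push_cast
  linear_combination (1 / 2) * hk

end IntegerValued

end UnitriangularCharacters

end

theorem mainTheorem1 :
    (∀ (F : Type u) [Field F] [Finite F] (q : ℕ), q = Nat.card F →
      -- the values for `n = 5, 6, 7`
      (UnitriangularCharacters.numIrredChar (q ^ 3) (UnitriangularCharacters.unitriangular 5 F) : ℚ)
          = q * (q - 1) * (2 * q - 1) ∧
      (UnitriangularCharacters.numIrredChar (q ^ 3) (UnitriangularCharacters.unitriangular 6 F) : ℚ)
          = q ^ 2 * (q - 1) * (4 * q ^ 2 + q - 3) ∧
      (UnitriangularCharacters.numIrredChar (q ^ 3) (UnitriangularCharacters.unitriangular 7 F) : ℚ)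
          = q ^ 2 * (q - 1) * (3 * q ^ 4 + 6 * q ^ 3 - 2 * q ^ 2 - 5 * q + 1) ∧
      -- the recursive formula
      (∀ n : ℕ, 8 ≤ n →
        (UnitriangularCharacters.numIrredChar (q ^ 3)
            (UnitriangularCharacters.unitriangular n F) : ℚ)
          = q * (UnitriangularCharacters.numIrredChar (q ^ 3)
              (UnitriangularCharacters.unitriangular (n - 1) F) : ℚ)
            + (q : ℚ) ^ (n - 5) * (q - 1) *
              ((q : ℚ) ^ 5 + (2 * n - 14) * q ^ 4
                + (25 - 3 * n + ((n : ℚ) - 6) * (n - 5) / 2) * q ^ 3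
                + (n - 11 - ((n : ℚ) - 7) * (n - 6)) * q ^ 2
                + (5 - n + ((n : ℚ) - 8) * (n - 7) / 2) * q + n - 6)) ∧
      -- the closed formula
      (∀ n : ℕ, 7 ≤ n →
        (UnitriangularCharacters.numIrredChar (q ^ 3)
            (UnitriangularCharacters.unitriangular n F) : ℚ)
          = (q : ℚ) ^ (n - 5) * (q - 1) *
              (UnitriangularCharacters.coeffA.eval (n : ℚ) * q ^ 5
                + UnitriangularCharacters.coeffB.eval (n : ℚ) * q ^ 4
                + UnitriangularCharacters.coeffC.eval (n : ℚ) * q ^ 3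
                + UnitriangularCharacters.coeffD.eval (n : ℚ) * q ^ 2
                + UnitriangularCharacters.coeffE.eval (n : ℚ) * q
                + UnitriangularCharacters.coeffF.eval (n : ℚ)))) ∧
    -- the coefficients are integer-valued polynomials in `n`
    (UnitriangularCharacters.IsIntegerValued UnitriangularCharacters.coeffA ∧
      UnitriangularCharacters.IsIntegerValued UnitriangularCharacters.coeffB ∧
      UnitriangularCharacters.IsIntegerValued UnitriangularCharacters.coeffC ∧
      UnitriangularCharacters.IsIntegerValued UnitriangularCharacters.coeffD ∧
      UnitriangularCharacters.IsIntegerValued UnitriangularCharacters.coeffE ∧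
      UnitriangularCharacters.IsIntegerValued UnitriangularCharacters.coeffF) ∧
    -- for each `n`, one integer polynomial gives the number for all finite fields
    (∀ n : ℕ, ∃ P : Polynomial ℤ, ∀ (F : Type u) [Field F] [Finite F] (q : ℕ), q = Nat.card F →
      (UnitriangularCharacters.numIrredChar (q ^ 3)
        (UnitriangularCharacters.unitriangular n F) : ℤ) = P.eval (q : ℤ)) := by
  open UnitriangularCharacters in
  refine ⟨fun F _ _ q hq => ?_, ⟨isIntegerValued_coeffA, isIntegerValued_coeffB,
    isIntegerValued_coeffC, isIntegerValued_coeffD, isIntegerValued_coeffE,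
    -- The recursion run in `ℤ[X]` has integer coefficients by construction, so the integrality of
    -- the coefficients in the closed formula is not needed here.
    isIntegerValued_coeffF⟩, fun n => ⟨chainThree Polynomial.X n, fun F _ _ q hq => ?_⟩⟩
  · subst hq
    simp only [numIrredChar_unitriangular]
    exact ⟨chainThree_five _, chainThree_six _, chainThree_seven _, chainThree_rec _,
      chainThree_closed _⟩
  · subst hq
    rw [numIrredChar_unitriangular, ← Polynomial.coe_evalRingHom, map_chainThree,
      Polynomial.coe_evalRingHom, Polynomial.eval_X]
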